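/- **Conventions.** Let $d,m$ be natural numbers, and let $|X|$ be the Euclidean (Frobenius) norm of $X\in\mathbb{R}^{d\times m}$. For $X\in\mathbb{R}^{d\times m}$, $b\in\mathbb{R}^d$ write $l_{X,b}(x)=Xx+b$. A *regular domain* is a nonempty, open, bounded, connected set $\Omega\subset\mathbb{R}^m$ with $|\partial\Omega|=0$. A map $w\in W^{1,1}(\Omega,\mathbb{R}^d)$ is *piecewise affine* if there is an at most countable family of pairwise disjoint regular domains $\Omega_i\subset\Omega$ with $|\Omega\setminus\bigcup_i\Omega_i|=0$ such that $w$ agrees with an affine map on each $\Omega_i$. $\nabla w$ is the weak gradient, and $\|w\|_{C^\alpha(\bar\Omega)}=\sup_{\bar\Omega}|w|+\sup_{x\ne y\in\bar\Omega}|w(x)-w(y)|/|x-y|^\alpha$. For $U,K\subset\mathbb{R}^{d\times m}$ and $1<p<\infty$, we say that *$U$ can be $U$-reduced to $K$ in weak $L^p$* if there is a constant $M\ge 1$ such that for all $X_0\in U$, $b\in\mathbb{R}^d$, $\varepsilon,\alpha\in(0,1)$, $q\in(1,\infty)$ and every regular domain $\Omega\subset\mathbb{R}^m$ there is a piecewise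 affine $w\in W^{1,1}(\Omega,\mathbb{R}^d)\cap C^\alpha(\bar\Omega,\mathbb{R}^d)$ with $w=l_{X_0,b}$ on $\partial\Omega$, $$|\{x\in\Omega:|\nabla w(x)|>t\}|\le M^p(1+|X_0|^p)\,|\Omega|\,t^{-p}\quad\text{for all }t>0,$$ and, with $\Omega_{err}=\{x\in\Omega:\nabla w(x)\notin K\}$, $$\nabla w(x)\in U\ \text{ for a.e. }x\in\Omega_{err},\qquad \int_{\Omega_{err}}(1+|\nabla w|)^q\,dx<\varepsilon|\Omega|.$$ We say that $U$ can be $U$-reduced to $K$ *exactly* in weak $L^p$ if there are constants $M\ge1$ and $c_0>0$ such that for all such data $w$ can be chosen to satisfy, in addition to all of the above, $|\{x\in\Omega:|\nabla w(x)|>t\}|\ge c_0^p\,|\Omega|\,t^{-p}$ for all $t>1$. **Theorem 1.2 (Exact solution).** Let $K\subset\mathbb{R}^{d\times m}$, let $U\subset\mathbb{R}^{d\times m}$ be open, let $1<p<\infty$, and suppose that $U$ can be $U$-reduced to $K$ in weak $L^p$. Then for any regular domain $\Omega\subset\mathbb{R}^m$, any $X_0\in U$, $b\in\mathbb{R}^d$,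 $\delta>0$ and $\alpha\in(0,1)$ there is a piecewise affine map $w\in W^{1,1}(\Omega,\mathbb{R}^d)\cap C^\alpha(\bar\Omega,\mathbb{R}^d)$ with $w=l_{X_0,b}$ on $\partial\Omega$ such that $$\nabla w(x)\in K\ \text{ for a.e. }x\in\Omega,\qquad \|w-l_{X_0,b}\|_{C^\alpha(\bar\Omega)}<\delta,$$ and there is a constant $C>0$ such that $|\{x\in\Omega:|\nabla w(x)|>t\}|\le C\,t^{-p}$ for all $t>0$. If moreover $U$ can be $U$-reduced to $K$ exactly in weak $L^p$, then $w$ can be chosen such that in addition, for some constant $c>0$, $|\{x\in\Omega:|\nabla w(x)|>t\}|\ge c\,t^{-p}$ for all $t\in(1,\infty)$. -/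

import Mathlib

open MeasureTheory Set
open scoped NNReal ENNReal ContDiff

/-- The affine map `l_{X,b}(x) = X x + b` from `ℝ^m` to `ℝ^d`. -/
noncomputable def affMap {d m : ℕ} (X : Matrix (Fin d) (Fin m) ℝ) (b : EuclideanSpace ℝ (Fin d))
    (x : EuclideanSpace ℝ (Fin m)) : EuclideanSpace ℝ (Fin d) :=
  Matrix.toEuclideanLin X x + b

/-- The Euclidean (Frobenius) norm `|X|` of a matrix `X ∈ ℝ^{d × m}`. -/
noncomputable def matNorm {d m : ℕ} (X : Matrix (Fin d) (Fin m) ℝ) : ℝ :=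
  √(∑ i, ∑ j, X i j ^ 2)

/-- Regular domains of `ℝ^m`: open, bounded, connected (and, as every domain, nonempty:
`IsConnected` includes this), with a boundary of Lebesgue measure zero. -/
structure IsRegularDomain {m : ℕ} (Ω : Set (EuclideanSpace ℝ (Fin m))) : Prop where
  isOpen : IsOpen Ω
  isBounded : Bornology.IsBounded Ω
  isConnected : IsConnected Ω
  volume_frontier : volume (frontier Ω) = 0

/-- `w ∈ W^{1,1}(Ω, ℝ^d)` and `G` is (a representative of) its weak gradient `∇w`, i.e.
`w` and `G` are integrable on `Ω` and `∫_Ω w_i ∂_j φ = - ∫_Ω G_{ij} φ` for all smooth `φ` with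
compact support in `Ω`. -/
structure IsW11 {d m : ℕ} (Ω : Set (EuclideanSpace ℝ (Fin m)))
    (w : EuclideanSpace ℝ (Fin m) → EuclideanSpace ℝ (Fin d))
    (G : EuclideanSpace ℝ (Fin m) → Matrix (Fin d) (Fin m) ℝ) : Prop where
  integrableOn : IntegrableOn w Ω
  integrableOn_grad : ∀ i j, IntegrableOn (fun x => G x i j) Ω
  integral_eq : ∀ φ : EuclideanSpace ℝ (Fin m) → ℝ, ContDiff ℝ ∞ φ → HasCompactSupport φ →
    tsupport φ ⊆ Ω → ∀ i j,
      ∫ x in Ω, w x i * fderiv ℝ φ x (EuclideanSpace.single j 1) = - ∫ x in Ω, G x i j * φ x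

/-- There is an at most countable family `S` of pairwise disjoint regular domains contained in `Ω`
that covers `Ω` up to a null set, such that `w` agrees with an affine map on each of them.
(A map is called piecewise affine on `Ω` if it is in `W^{1,1}(Ω, ℝ^d)` and has this property.) -/
def IsPiecewiseAffineOn {d m : ℕ} (Ω : Set (EuclideanSpace ℝ (Fin m)))
    (w : EuclideanSpace ℝ (Fin m) → EuclideanSpace ℝ (Fin d)) : Prop :=
  ∃ S : Set (Set (EuclideanSpace ℝ (Fin m))), S.Countable ∧ S.PairwiseDisjoint id ∧
    (∀ D ∈ S, IsRegularDomain D ∧ D ⊆ Ω ∧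
      ∃ (X : Matrix (Fin d) (Fin m) ℝ) (b : EuclideanSpace ℝ (Fin d)), ∀ x ∈ D, w x = affMap X b x) ∧
    volume (Ω \ ⋃₀ S) = 0

/-- The Hölder norm `‖w‖_{C^α(A)} = sup_A |w| + sup_{x ≠ y in A} |w x - w y| / |x - y|^α`,
as an extended nonnegative number. -/
noncomputable def holderENorm {d m : ℕ} (α : ℝ≥0) (A : Set (EuclideanSpace ℝ (Fin m)))
    (w : EuclideanSpace ℝ (Fin m) → EuclideanSpace ℝ (Fin d)) : ℝ≥0∞ :=
  (⨆ x ∈ A, ‖w x‖ₑ) + eHolderNorm α (A.domRestrict w)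

/-- `w` is a piecewise affine map in `W^{1,1}(Ω, ℝ^d) ∩ C^α(Ω̄, ℝ^d)` with weak gradient `G` and
with `w(x) = X₀ x + b` on `∂Ω`. -/
structure IsPiecewiseAffineWithData {d m : ℕ} (Ω : Set (EuclideanSpace ℝ (Fin m)))
    (α : ℝ≥0) (X₀ : Matrix (Fin d) (Fin m) ℝ) (b : EuclideanSpace ℝ (Fin d))
    (w : EuclideanSpace ℝ (Fin m) → EuclideanSpace ℝ (Fin d))
    (G : EuclideanSpace ℝ (Fin m) → Matrix (Fin d) (Fin m) ℝ) : Prop where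
  isW11 : IsW11 Ω w G
  isPiecewiseAffineOn : IsPiecewiseAffineOn Ω w
  holder : holderENorm α (closure Ω) w < ⊤
  boundary : ∀ x ∈ frontier Ω, w x = affMap X₀ b x

/-- The requirements on a map `w` with gradient `G` in the definition of reducibility in weak
`L^p` with constant `M`, for the data `Ω, X₀, b, ε, α, q`. -/
structure IsReducingMap {d m : ℕ} (U K : Set (Matrix (Fin d) (Fin m) ℝ)) (p M : ℝ)
    (Ω : Set (EuclideanSpace ℝ (Fin m))) (X₀ : Matrix (Fin d) (Fin m) ℝ)
    (b : EuclideanSpace ℝ (Fin d)) (ε : ℝ) (α : ℝ≥0) (q : ℝ)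
    (w : EuclideanSpace ℝ (Fin m) → EuclideanSpace ℝ (Fin d))
    (G : EuclideanSpace ℝ (Fin m) → Matrix (Fin d) (Fin m) ℝ) : Prop where
  data : IsPiecewiseAffineWithData Ω α X₀ b w G
  upper : ∀ t : ℝ, 0 < t → volume {x ∈ Ω | t < matNorm (G x)} ≤
    ENNReal.ofReal (M ^ p * (1 + matNorm X₀ ^ p) * t ^ (-p)) * volume Ω
  error_mem : ∀ᵐ x ∂(volume.restrict Ω), G x ∉ K → G x ∈ U
  error_small : ∫⁻ x in {x ∈ Ω | G x ∉ K}, ENNReal.ofReal ((1 + matNorm (G x)) ^ q) <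
    ENNReal.ofReal ε * volume Ω

/-- `U` can be `U`-reduced to `K` in weak `L^p`. -/
def CanBeReduced {d m : ℕ} (U K : Set (Matrix (Fin d) (Fin m) ℝ)) (p : ℝ) : Prop :=
  ∃ M : ℝ, 1 ≤ M ∧
    ∀ X₀ ∈ U, ∀ b : EuclideanSpace ℝ (Fin d), ∀ ε : ℝ, 0 < ε → ε < 1 → ∀ α : ℝ≥0, 0 < α → α < 1 →
      ∀ q : ℝ, 1 < q → ∀ Ω : Set (EuclideanSpace ℝ (Fin m)), IsRegularDomain Ω →
        ∃ (w : EuclideanSpace ℝ (Fin m) → EuclideanSpace ℝ (Fin d))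
          (G : EuclideanSpace ℝ (Fin m) → Matrix (Fin d) (Fin m) ℝ),
          IsReducingMap U K p M Ω X₀ b ε α q w G

/-- `U` can be `U`-reduced to `K` exactly in weak `L^p`: the maps `w` satisfy in addition a lower
bound with a constant `c₀ > 0` that, like `M`, depends on `U, K, p` only. -/
def CanBeReducedExactly {d m : ℕ} (U K : Set (Matrix (Fin d) (Fin m) ℝ)) (p : ℝ) : Prop :=
  ∃ M : ℝ, 1 ≤ M ∧ ∃ c₀ : ℝ, 0 < c₀ ∧
    ∀ X₀ ∈ U, ∀ b : EuclideanSpace ℝ (Fin d), ∀ ε : ℝ, 0 < ε → ε < 1 → ∀ α : ℝ≥0, 0 < α → α < 1 →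
      ∀ q : ℝ, 1 < q → ∀ Ω : Set (EuclideanSpace ℝ (Fin m)), IsRegularDomain Ω →
        ∃ (w : EuclideanSpace ℝ (Fin m) → EuclideanSpace ℝ (Fin d))
          (G : EuclideanSpace ℝ (Fin m) → Matrix (Fin d) (Fin m) ℝ),
          IsReducingMap U K p M Ω X₀ b ε α q w G ∧
          ∀ t : ℝ, 1 < t →
            ENNReal.ofReal (c₀ ^ p * t ^ (-p)) * volume Ω ≤ volume {x ∈ Ω | t < matNorm (G x)}

open Filter Topology

/-! The solution is the sum of the affine boundary datum and a series of corrections, each supported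
where the gradient has not yet reached `K`. After step `n` the current gradient `G n` is locally
constant on an open bad set `B n`, with values in `U`. There each point has arbitrarily small balls
on which `G n` is a constant `X ∈ U`. Reducibility on the unit ball, with zero translation and with
exponent `q = p`, gives a map `w` with boundary values `X x`; extending `w - X x` by zero gives a
model correction (`IsReducingMap.exists_isCorrection`). Rescaling it to a ball of radius `r` leaves
gradients and volume fractions unchanged and multiplies the Hölder seminorm by `r ^ (1 - α)`.
Disjoint small balls covering `B n` up to a null set thus carry a correction as small as desired in
`C^α` (`IsCorrection.exists_of_ball`).

The choice `q = p` closes the iteration. The weak bound for step `n` is `M ^ p * t ^ (-p)` times the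
integral of `(1 + |G n|) ^ p` over `B n`, and the error estimate of the preceding step makes this
integral at most `ε (n - 1) * |Ω|`. With `ε` summable these integrals are summable, which has three
consequences. The bad sets decrease to a null set, so almost every point settles after finitely many
steps, with gradient in `K`. The weak bounds add up to a single weak `L^p` bound. Since `p > 1`, the
gradients of the corrections are absolutely summable in `L^1`, so the sum of the series has the sum
of the gradients as weak gradient. Near a settled point the gradient is locally constant in `K` and
later corrections vanish, so the sum is locally affine almost everywhere; the pieces are connected
components.

For the lower bound only the first step matters: it satisfies the lower bound with `c₀ ^ p`, and
later steps alter the gradient only on `B 1`, where Chebyshev's inequality costs at most `ε 0 * t ^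
(-p) * |Ω|`. Taking `ε 0 ≤ c₀ ^ p / 2` keeps half of it. -/

/-- `f` is affine with slope `H x`, and `H` is constant, in a neighbourhood of `x`. -/
def AffineNear {d m : ℕ} (f : EuclideanSpace ℝ (Fin m) → EuclideanSpace ℝ (Fin d))
    (H : EuclideanSpace ℝ (Fin m) → Matrix (Fin d) (Fin m) ℝ) (x : EuclideanSpace ℝ (Fin m)) :
    Prop :=
  ∀ᶠ y in 𝓝 x, f y = f x + Matrix.toEuclideanLin (H x) (y - x) ∧ H y = H x

/-! ### Locally affine maps and piecewise affinity -/

section AffineNear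

variable {d m : ℕ} {f g : EuclideanSpace ℝ (Fin m) → EuclideanSpace ℝ (Fin d)}
  {H J : EuclideanSpace ℝ (Fin m) → Matrix (Fin d) (Fin m) ℝ} {x : EuclideanSpace ℝ (Fin m)}

theorem AffineNear.eventually (h : AffineNear f H x) : ∀ᶠ y in 𝓝 x, AffineNear f H y := by
  have h2 := eventually_eventually_nhds.mpr h
  filter_upwards [h2, h] with y hy hyx
  filter_upwards [hy] with z hz
  refine ⟨?_, hz.2.trans hyx.2.symm⟩
  rw [hz.1, hyx.1, hyx.2, add_assoc, ← map_add]
  congr 2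
  abel

theorem isOpen_affineNear : IsOpen {x | AffineNear f H x} :=
  isOpen_iff_mem_nhds.mpr fun _ h => AffineNear.eventually h

theorem AffineNear.congr (h : AffineNear f H x) (hf : g =ᶠ[𝓝 x] f) (hH : J =ᶠ[𝓝 x] H) :
    AffineNear g J x := by
  filter_upwards [h, hf, hH] with y hy hfy hHy
  rw [hfy, hHy, hf.self_of_nhds, hH.self_of_nhds]
  exact hy

theorem AffineNear.add (h : AffineNear f H x) (h' : AffineNear g J x) :
    AffineNear (fun y => f y + g y) (fun y => H y + J y) x := by
  filter_upwards [h, h'] with y hy hy'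
  refine ⟨?_, by rw [hy.2, hy'.2]⟩
  simp only [hy.1, hy'.1, map_add, LinearMap.add_apply]
  abel

theorem affineNear_affMap (X : Matrix (Fin d) (Fin m) ℝ) (b : EuclideanSpace ℝ (Fin d)) :
    AffineNear (affMap X b) (fun _ => X) x := by
  refine Eventually.of_forall fun y => ⟨?_, rfl⟩
  simp only [affMap, map_sub]
  abel

theorem affineNear_zero :
    AffineNear (fun _ => (0 : EuclideanSpace ℝ (Fin d)))
      (fun _ => (0 : Matrix (Fin d) (Fin m) ℝ)) x :=
  Eventually.of_forall fun y => by simp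

theorem AffineNear.sum {ι : Type*} (s : Finset ι)
    {f : ι → EuclideanSpace ℝ (Fin m) → EuclideanSpace ℝ (Fin d)}
    {H : ι → EuclideanSpace ℝ (Fin m) → Matrix (Fin d) (Fin m) ℝ}
    (h : ∀ i ∈ s, AffineNear (f i) (H i) x) :
    AffineNear (fun y => ∑ i ∈ s, f i y) (fun y => ∑ i ∈ s, H i y) x := by
  classical
  induction s using Finset.induction_on with
  | empty => simpa using affineNear_zero
  | insert a s ha ih =>
    simp only [Finset.sum_insert ha]
    exact (h a (by simp)).add (ih fun i hi => h i (by simp [hi]))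

theorem AffineNear.rescale (a : EuclideanSpace ℝ (Fin m)) {r : ℝ} (hr : r ≠ 0)
    (h : AffineNear f H (r⁻¹ • (x - a))) :
    AffineNear (fun y => r • f (r⁻¹ • (y - a))) (fun y => H (r⁻¹ • (y - a))) x := by
  have hc : Tendsto (fun y : EuclideanSpace ℝ (Fin m) => r⁻¹ • (y - a)) (𝓝 x)
      (𝓝 (r⁻¹ • (x - a))) := by
    apply Continuous.tendsto; fun_prop
  filter_upwards [hc.eventually h] with y hy
  refine ⟨?_, hy.2⟩
  rw [hy.1, smul_add, ← smul_sub, map_smul, smul_smul, mul_inv_cancel₀ hr, one_smul]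
  congr 2
  abel

theorem affineNear_of_eqOn {D : Set (EuclideanSpace ℝ (Fin m))} (hD : IsOpen D)
    {X : Matrix (Fin d) (Fin m) ℝ} {b : EuclideanSpace ℝ (Fin d)}
    (hf : ∀ y ∈ D, f y = affMap X b y) (hH : ∀ y ∈ D, H y = X) (hx : x ∈ D) :
    AffineNear f H x :=
  (affineNear_affMap X b).congr
    (by filter_upwards [hD.mem_nhds hx] with y hy using hf y hy)
    (by filter_upwards [hD.mem_nhds hx] with y hy using hH y hy)

/-- A map that is affine near almost every point of a regular domain is piecewise affine. The
pieces are the connected components of the open set of all such points. -/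
theorem isPiecewiseAffineOn_of_affineNear {Ω : Set (EuclideanSpace ℝ (Fin m))}
    (hΩ : IsRegularDomain Ω) (h : ∀ᵐ x, x ∈ Ω → AffineNear f H x) : IsPiecewiseAffineOn Ω f := by
  set V : Set (EuclideanSpace ℝ (Fin m)) := Ω ∩ {x | AffineNear f H x} with hV
  have hVo : IsOpen V := hΩ.isOpen.inter isOpen_affineNear
  have hdiff : volume (Ω \ V) = 0 := by
    refine measure_mono_null ?_ (ae_iff.mp h)
    rintro x ⟨hx, hxV⟩ hxx
    exact hxV ⟨hx, hxx hx⟩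
  have hdisj : (connectedComponentIn V '' V).PairwiseDisjoint id := by
    rintro _ ⟨x, hx, rfl⟩ _ ⟨y, hy, rfl⟩ hne
    refine Set.disjoint_left.mpr fun z hzx hzy => hne ?_
    rw [connectedComponentIn_eq hzx, connectedComponentIn_eq hzy]
  refine ⟨connectedComponentIn V '' V, ?_, hdisj, ?_, ?_⟩
  · refine hdisj.countable_of_isOpen ?_ ?_
    · rintro _ ⟨x, hx, rfl⟩
      exact hVo.connectedComponentIn
    · rintro _ ⟨x, hx, rfl⟩
      exact ⟨x, mem_connectedComponentIn hx⟩
  · rintro _ ⟨x, hx, rfl⟩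
    have hsub : connectedComponentIn V x ⊆ V := connectedComponentIn_subset V x
    refine ⟨⟨hVo.connectedComponentIn, hΩ.isBounded.subset (hsub.trans inter_subset_left),
      ⟨⟨x, mem_connectedComponentIn hx⟩, isPreconnected_connectedComponentIn⟩, ?_⟩,
      hsub.trans inter_subset_left, H x, f x - Matrix.toEuclideanLin (H x) x, ?_⟩
    -- A frontier point of a component that lay in `V` would have an open component of its own
    -- meeting the given one; the two would coincide and the point would be interior.
    · refine measure_mono_null (t := (Ω \ V) ∪ frontier Ω) ?_
        (measure_union_null hdiff hΩ.volume_frontier)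
      intro y hy
      have hyV : y ∉ V := by
        intro hyV
        obtain ⟨z, hz1, hz2⟩ := mem_closure_iff.mp hy.1 _ hVo.connectedComponentIn
          (mem_connectedComponentIn hyV)
        refine hy.2 ?_
        rw [hVo.connectedComponentIn.interior_eq, connectedComponentIn_eq hz2,
          ← connectedComponentIn_eq hz1]
        exact mem_connectedComponentIn hyV
      by_cases hyΩ : y ∈ Ω
      · exact Or.inl ⟨hyΩ, hyV⟩
      · refine Or.inr ⟨closure_mono (hsub.trans inter_subset_left) hy.1, ?_⟩
        rwa [hΩ.isOpen.interior_eq]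
    · intro y hy
      set C := connectedComponentIn V x
      have : PreconnectedSpace C :=
        isPreconnected_iff_preconnectedSpace.mp isPreconnected_connectedComponentIn
      -- Slope and intercept together are locally constant, hence constant on the connected
      -- component.
      have hloc : IsLocallyConstant
          fun z : C => (H z, f z - Matrix.toEuclideanLin (H z) (z : EuclideanSpace ℝ (Fin m))) := by
        rw [IsLocallyConstant.iff_eventually_eq]
        rintro ⟨z, hz⟩
        have := (hsub hz).2
        filter_upwards [continuous_subtype_val.continuousAt.eventually this] with u hu
        simp only [Prod.mk.injEq]
        refine ⟨hu.2, ?_⟩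
        rw [hu.2, hu.1, map_sub]
        abel
      have := hloc.apply_eq_of_isPreconnected isPreconnected_univ (mem_univ ⟨y, hy⟩)
        (mem_univ ⟨x, mem_connectedComponentIn hx⟩)
      simp only [Prod.mk.injEq] at this
      rw [affMap, ← this.2, this.1]
      abel
  · refine measure_mono_null ?_ hdiff
    rintro y ⟨hy, hyS⟩
    exact ⟨hy, fun hyV => hyS ⟨_, ⟨y, hyV, rfl⟩, mem_connectedComponentIn hyV⟩⟩

end AffineNear

/-- `f` and `H` are integrable on `ℝ^m` and `H` is the weak gradient of `f` on `ℝ^m`. -/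
structure HasWeakGrad {d m : ℕ} (f : EuclideanSpace ℝ (Fin m) → EuclideanSpace ℝ (Fin d))
    (H : EuclideanSpace ℝ (Fin m) → Matrix (Fin d) (Fin m) ℝ) : Prop where
  integrable : Integrable f
  integrable_grad : ∀ i j, Integrable (fun x => H x i j)
  integral_eq : ∀ φ : EuclideanSpace ℝ (Fin m) → ℝ, ContDiff ℝ ∞ φ → HasCompactSupport φ →
    ∀ i j, ∫ x, f x i * fderiv ℝ φ x (EuclideanSpace.single j 1) = - ∫ x, H x i j * φ x

/-! ### Integration of absolutely summable series -/

section SumIntegral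

variable {X ι : Type*} [MeasurableSpace X] {μ : Measure X} [Countable ι]
  {E : Type*} [NormedAddCommGroup E] {u : ι → X → E} {v : X → E}

theorem integrable_of_hasSum (hu : ∀ i, Integrable (u i) μ)
    (hs : ∑' i, ∫⁻ x, ‖u i x‖ₑ ∂μ ≠ ⊤) (hv : ∀ᵐ x ∂μ, HasSum (fun i => u i x) (v x)) :
    Integrable v μ := by
  have hle : ∀ᵐ x ∂μ, ‖v x‖ₑ ≤ ∑' i, ‖u i x‖ₑ := by
    filter_upwards [hv] with x hx
    rw [← hx.tsum_eq]
    exact enorm_tsum_le_tsum_enorm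
  refine ⟨aestronglyMeasurable_of_tendsto_ae (u := (atTop : Filter (Finset ι)))
    (f := fun s x => ∑ i ∈ s, u i x) (fun s => ?_) hv, ?_⟩
  · exact s.aestronglyMeasurable_fun_sum fun i _ => (hu i).1
  · rw [hasFiniteIntegral_iff_enorm]
    calc ∫⁻ x, ‖v x‖ₑ ∂μ ≤ ∫⁻ x, ∑' i, ‖u i x‖ₑ ∂μ := lintegral_mono_ae hle
      _ = ∑' i, ∫⁻ x, ‖u i x‖ₑ ∂μ := lintegral_tsum fun i => (hu i).1.enorm
      _ < ⊤ := hs.lt_top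

theorem hasSum_integral_mul {u : ι → X → ℝ} {v ψ : X → ℝ} (hu : ∀ i, Integrable (u i) μ)
    (hs : ∑' i, ∫⁻ x, ‖u i x‖ₑ ∂μ ≠ ⊤) (hv : ∀ᵐ x ∂μ, HasSum (fun i => u i x) (v x))
    (hψ : AEStronglyMeasurable ψ μ) {C : ℝ} (hC : ∀ x, ‖ψ x‖ ≤ C) :
    HasSum (fun i => ∫ x, u i x * ψ x ∂μ) (∫ x, v x * ψ x ∂μ) := by
  have hint : ∀ i, Integrable (fun x => u i x * ψ x) μ := fun i =>
    (hu i).mul_bdd hψ (Eventually.of_forall hC)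
  have hsum : Summable fun i => ∫ x, ‖u i x * ψ x‖ ∂μ := by
    have h1 : Summable fun i => ∫ x, ‖u i x‖ ∂μ := by
      refine Summable.of_enorm ?_
      convert hs using 3 with i
      rw [← ofReal_norm, Real.norm_of_nonneg (by positivity), ofReal_integral_norm_eq_lintegral_enorm (hu i)]
    refine (h1.mul_right C).of_nonneg_of_le (fun i => by positivity) fun i => ?_
    rw [← integral_mul_const]
    refine integral_mono (hint i).norm ((hu i).norm.mul_const C) fun x => ?_
    simp only [norm_mul]
    gcongr
    exact hC x
  have := hasSum_integral_of_summable_integral_norm hint hsum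
  have he : ∫ x, v x * ψ x ∂μ = ∫ x, ∑' i, u i x * ψ x ∂μ := by
    refine integral_congr_ae ?_
    filter_upwards [hv] with x hx
    exact (hx.mul_right (ψ x)).tsum_eq.symm
  rwa [he]

end SumIntegral

/-! ### Weak gradients: countable sums and affine pieces -/

section WeakGrad

variable {d m : ℕ} {f : EuclideanSpace ℝ (Fin m) → EuclideanSpace ℝ (Fin d)}
  {H : EuclideanSpace ℝ (Fin m) → Matrix (Fin d) (Fin m) ℝ}

theorem matrix_toEuclideanLin_apply_apply (X : Matrix (Fin d) (Fin m) ℝ)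
    (x : EuclideanSpace ℝ (Fin m)) (i : Fin d) :
    Matrix.toEuclideanLin X x i = ∑ j, X i j * x j := by
  simp [Matrix.toEuclideanLin, Matrix.mulVec, dotProduct]

theorem matrix_toEuclideanLin_single (X : Matrix (Fin d) (Fin m) ℝ) (i : Fin d) (j : Fin m) :
    Matrix.toEuclideanLin X (EuclideanSpace.single j (1 : ℝ)) i = X i j := by
  rw [matrix_toEuclideanLin_apply_apply, Finset.sum_eq_single j] <;> simp +contextual

theorem continuous_affMap (X : Matrix (Fin d) (Fin m) ℝ) (b : EuclideanSpace ℝ (Fin d)) :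
    Continuous (affMap X b) :=
  (LinearMap.continuous_of_finiteDimensional (Matrix.toEuclideanLin X)).add continuous_const

theorem contDiff_fderiv_apply {φ : EuclideanSpace ℝ (Fin m) → ℝ} (hφ : ContDiff ℝ ∞ φ)
    (v : EuclideanSpace ℝ (Fin m)) : Continuous fun x => fderiv ℝ φ x v :=
  (hφ.continuous_fderiv (by simp)).clm_apply continuous_const

/-- Tested against a bounded function, a series that is absolutely summable in `L^1` may be
integrated term by term, so integration by parts passes to the sum. This serves both for the pieces
glued in one step and for the sequence of steps. -/
theorem HasWeakGrad.of_hasSum {ι : Type*} [Countable ι]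
    {u : ι → EuclideanSpace ℝ (Fin m) → EuclideanSpace ℝ (Fin d)}
    {L : ι → EuclideanSpace ℝ (Fin m) → Matrix (Fin d) (Fin m) ℝ}
    (h : ∀ k, HasWeakGrad (u k) (L k)) (hu : ∑' k, ∫⁻ x, ‖u k x‖ₑ ≠ ⊤)
    (hL : ∀ i j, ∑' k, ∫⁻ x, ‖L k x i j‖ₑ ≠ ⊤)
    (hf : ∀ᵐ x, HasSum (fun k => u k x) (f x)) (hH : ∀ᵐ x, HasSum (fun k => L k x) (H x)) :
    HasWeakGrad f H := by
  have hH' : ∀ i j, ∀ᵐ x, HasSum (fun k => L k x i j) (H x i j) := fun i j => by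
    filter_upwards [hH] with x hx
    exact Pi.hasSum.mp (Pi.hasSum.mp hx i) j
  refine ⟨integrable_of_hasSum (fun k => (h k).integrable) hu hf, fun i j =>
    integrable_of_hasSum (fun k => (h k).integrable_grad i j) (hL i j) (hH' i j), ?_⟩
  intro φ hφ hφc i j
  obtain ⟨C₁, hC₁⟩ := (hφc.fderiv_apply ℝ (EuclideanSpace.single j 1)).exists_bound_of_continuous
    (contDiff_fderiv_apply hφ _)
  obtain ⟨C₂, hC₂⟩ := hφc.exists_bound_of_continuous hφ.continuous
  have h1 : HasSum (fun k => ∫ x, u k x i * fderiv ℝ φ x (EuclideanSpace.single j 1))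
      (∫ x, f x i * fderiv ℝ φ x (EuclideanSpace.single j 1)) := by
    refine hasSum_integral_mul (fun k => ?_) ?_ ?_
      (contDiff_fderiv_apply hφ _).aestronglyMeasurable hC₁
    · exact (EuclideanSpace.proj (𝕜 := ℝ) i).integrable_comp (h k).integrable
    · refine ne_top_of_le_ne_top hu (ENNReal.tsum_le_tsum fun k => lintegral_mono fun x => ?_)
      exact enorm_le_iff_norm_le.mpr (PiLp.norm_apply_le (u k x) i)
    · filter_upwards [hf] with x hx
      exact (EuclideanSpace.proj (𝕜 := ℝ) i).hasSum hx
  have h2 : HasSum (fun k => ∫ x, L k x i j * φ x) (∫ x, H x i j * φ x) :=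
    hasSum_integral_mul (fun k => (h k).integrable_grad i j) (hL i j) (hH' i j)
      hφ.continuous.aestronglyMeasurable hC₂
  simp only [fun k => (h k).integral_eq φ hφ hφc i j] at h1
  exact h1.unique h2.neg

theorem integral_affMap_mul_fderiv (X : Matrix (Fin d) (Fin m) ℝ) (b : EuclideanSpace ℝ (Fin d))
    {φ : EuclideanSpace ℝ (Fin m) → ℝ} (hφ : ContDiff ℝ ∞ φ) (hφc : HasCompactSupport φ)
    (i : Fin d) (j : Fin m) :
    ∫ x, affMap X b x i * fderiv ℝ φ x (EuclideanSpace.single j 1) = - ∫ x, X i j * φ x := by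
  set L : EuclideanSpace ℝ (Fin m) →L[ℝ] ℝ :=
    (EuclideanSpace.proj (𝕜 := ℝ) i).comp (LinearMap.toContinuousLinearMap (Matrix.toEuclideanLin X))
  have hd : ∀ x, HasFDerivAt (fun x => affMap X b x i) L x := fun x => by
    have := L.hasFDerivAt (x := x)
    exact this.add_const (b i)
  have hfd : ∀ x, fderiv ℝ (fun x => affMap X b x i) x (EuclideanSpace.single j 1) = X i j :=
    fun x => by rw [(hd x).fderiv]; exact matrix_toEuclideanLin_single X i j
  have hc : Continuous fun x => affMap X b x i :=
    (EuclideanSpace.proj (𝕜 := ℝ) i).continuous.comp (continuous_affMap X b)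
  rw [integral_mul_fderiv_eq_neg_fderiv_mul_of_integrable]
  · simp only [hfd]
  · simp only [hfd]
    exact (hφ.continuous.integrable_of_hasCompactSupport hφc).const_mul _
  · exact (hc.mul (contDiff_fderiv_apply hφ _)).integrable_of_hasCompactSupport
      (hφc.fderiv_apply ℝ _).mul_left
  · exact (hc.mul hφ.continuous).integrable_of_hasCompactSupport hφc.mul_left
  · exact fun x _ => (hd x).differentiableAt
  · exact fun x _ => hφ.differentiable (by simp) x

theorem setIntegral_mul_of_tsupport_subset {Ω : Set (EuclideanSpace ℝ (Fin m))}
    {φ : EuclideanSpace ℝ (Fin m) → ℝ} (hφ : tsupport φ ⊆ Ω) (g : EuclideanSpace ℝ (Fin m) → ℝ) :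
    ∫ x in Ω, g x * φ x = ∫ x, g x * φ x :=
  setIntegral_eq_integral_of_forall_compl_eq_zero fun x hx => by
    rw [image_eq_zero_of_notMem_tsupport fun h => hx (hφ h), mul_zero]

theorem setIntegral_mul_fderiv_of_tsupport_subset {Ω : Set (EuclideanSpace ℝ (Fin m))}
    {φ : EuclideanSpace ℝ (Fin m) → ℝ} (hφ : tsupport φ ⊆ Ω) (g : EuclideanSpace ℝ (Fin m) → ℝ)
    (v : EuclideanSpace ℝ (Fin m)) :
    ∫ x in Ω, g x * fderiv ℝ φ x v = ∫ x, g x * fderiv ℝ φ x v :=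
  setIntegral_mul_of_tsupport_subset ((tsupport_fderiv_apply_subset ℝ v).trans hφ) g

/-- The weak gradient of a map which is affine on an open set is its slope there. -/
theorem IsW11.ae_eq_of_eqOn_affMap {Ω D : Set (EuclideanSpace ℝ (Fin m))} (h : IsW11 Ω f H)
    (hD : IsOpen D) (hDΩ : D ⊆ Ω) {X : Matrix (Fin d) (Fin m) ℝ} {b : EuclideanSpace ℝ (Fin d)}
    (hX : ∀ x ∈ D, f x = affMap X b x) : ∀ᵐ x, x ∈ D → H x = X := by
  have key : ∀ i j, ∀ᵐ x, x ∈ D → H x i j - X i j = 0 := by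
    intro i j
    have hint : LocallyIntegrableOn (fun x => H x i j) D :=
      (h.integrableOn_grad i j).locallyIntegrableOn.mono_set hDΩ
    have hconst : LocallyIntegrableOn (fun _ : EuclideanSpace ℝ (Fin m) => X i j) D :=
      (locallyIntegrable_const _).locallyIntegrableOn D
    -- The fundamental lemma of the calculus of variations on `D`: a test function supported in `D`
    -- sees only the affine formula for `f`.
    refine hD.ae_eq_zero_of_integral_contDiff_smul_eq_zero (hint.sub hconst) ?_
    intro φ hφ hφc hφD
    have e1 := h.integral_eq φ hφ hφc (hφD.trans hDΩ) i j
    have e2 := integral_affMap_mul_fderiv X b hφ hφc i j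
    rw [setIntegral_mul_of_tsupport_subset (hφD.trans hDΩ) (fun x => H x i j),
      setIntegral_mul_fderiv_of_tsupport_subset (hφD.trans hDΩ) (fun x => f x i),
      ← setIntegral_mul_fderiv_of_tsupport_subset hφD (fun x => f x i)] at e1
    rw [← setIntegral_mul_fderiv_of_tsupport_subset hφD (fun x => affMap X b x i),
      ← setIntegral_congr_fun hD.measurableSet (f := fun x => f x i * fderiv ℝ φ x (EuclideanSpace.single j 1))
        (fun x hx => by simp only [hX x hx]), e1, neg_inj] at e2
    have i1 : Integrable fun x => H x i j * φ x := by
      have : IntegrableOn (fun x => H x i j * φ x) Ω := by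
        obtain ⟨C, hC⟩ := hφc.exists_bound_of_continuous hφ.continuous
        exact (h.integrableOn_grad i j).mul_bdd hφ.continuous.aestronglyMeasurable
          (Eventually.of_forall hC)
      rwa [integrableOn_iff_integrable_of_support_subset] at this
      intro x hx
      exact hDΩ (hφD (subset_tsupport _ (right_ne_zero_of_mul hx)))
    have i2 : Integrable fun x => X i j * φ x :=
      (hφ.continuous.integrable_of_hasCompactSupport hφc).const_mul _
    have : ∀ x, φ x • (H x i j - X i j) = H x i j * φ x - X i j * φ x :=
      fun x => by rw [smul_eq_mul]; ring
    change ∫ x, φ x • (H x i j - X i j) = 0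
    simp only [this]
    rw [integral_sub i1 i2, e2, sub_self]
  have := ae_all_iff.mpr fun i => ae_all_iff.mpr (key i)
  filter_upwards [this] with x hx hxD
  ext i j
  exact sub_eq_zero.mp (hx i j hxD)

end WeakGrad

/-! ### Rescaling balls to the unit ball -/

section Rescale

variable {m : ℕ}

/-- The homeomorphism `x ↦ (x - a) / r`, which maps the ball `B(a, r)` to the unit ball. -/
noncomputable def rescaleHomeomorph (a : EuclideanSpace ℝ (Fin m)) {r : ℝ} (hr : r ≠ 0) :
    EuclideanSpace ℝ (Fin m) ≃ₜ EuclideanSpace ℝ (Fin m) :=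
  (Homeomorph.subRight a).trans (Homeomorph.smulOfNeZero r⁻¹ (inv_ne_zero hr))

theorem rescaleHomeomorph_apply (a : EuclideanSpace ℝ (Fin m)) {r : ℝ} (hr : r ≠ 0)
    (x : EuclideanSpace ℝ (Fin m)) : rescaleHomeomorph a hr x = r⁻¹ • (x - a) := rfl

theorem map_rescale (a : EuclideanSpace ℝ (Fin m)) {r : ℝ} (hr : 0 < r) :
    Measure.map (rescaleHomeomorph a hr.ne') volume = ENNReal.ofReal (r ^ m) • volume := by
  have h1 : (rescaleHomeomorph a hr.ne' : EuclideanSpace ℝ (Fin m) → EuclideanSpace ℝ (Fin m)) =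
      (fun x => r⁻¹ • x) ∘ fun x => x - a := rfl
  rw [h1, ← Measure.map_map (by fun_prop) (by fun_prop), map_sub_right_eq_self,
    Measure.map_addHaar_smul _ (inv_ne_zero hr.ne')]
  simp [abs_of_pos hr]

theorem measure_preimage_rescale (a : EuclideanSpace ℝ (Fin m)) {r : ℝ} (hr : 0 < r)
    (s : Set (EuclideanSpace ℝ (Fin m))) :
    volume (rescaleHomeomorph a hr.ne' ⁻¹' s) = ENNReal.ofReal (r ^ m) * volume s := by
  have := (rescaleHomeomorph a hr.ne').toMeasurableEquiv.map_apply (μ := volume) s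
  rw [Homeomorph.toMeasurableEquiv_coe, map_rescale a hr] at this
  rw [← this, Measure.smul_apply, smul_eq_mul]

theorem setLIntegral_rescale (a : EuclideanSpace ℝ (Fin m)) {r : ℝ} (hr : 0 < r)
    (s : Set (EuclideanSpace ℝ (Fin m))) (g : EuclideanSpace ℝ (Fin m) → ℝ≥0∞) :
    ∫⁻ x in rescaleHomeomorph a hr.ne' ⁻¹' s, g (rescaleHomeomorph a hr.ne' x) =
      ENNReal.ofReal (r ^ m) * ∫⁻ x in s, g x := by
  have := (rescaleHomeomorph a hr.ne').toMeasurableEquiv.restrict_map volume s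
  have h2 := lintegral_map_equiv (μ := volume.restrict (rescaleHomeomorph a hr.ne' ⁻¹' s)) g
    (rescaleHomeomorph a hr.ne').toMeasurableEquiv
  simp only [Homeomorph.toMeasurableEquiv_coe] at this h2
  rw [← h2, ← this, map_rescale a hr, Measure.restrict_smul, lintegral_smul_measure, smul_eq_mul]

theorem integral_rescale (a : EuclideanSpace ℝ (Fin m)) {r : ℝ} (hr : 0 < r)
    (g : EuclideanSpace ℝ (Fin m) → ℝ) :
    ∫ x, g (rescaleHomeomorph a hr.ne' x) = r ^ m * ∫ x, g x := by
  have h2 := integral_map_equiv (μ := volume)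
    (rescaleHomeomorph a hr.ne').toMeasurableEquiv g
  simp only [Homeomorph.toMeasurableEquiv_coe] at h2
  rw [← h2, map_rescale a hr, integral_smul_measure, ENNReal.toReal_ofReal (by positivity),
    smul_eq_mul]

theorem MeasureTheory.Integrable.rescale {E : Type*} [NormedAddCommGroup E]
    (a : EuclideanSpace ℝ (Fin m)) {r : ℝ} (hr : 0 < r)
    {g : EuclideanSpace ℝ (Fin m) → E} (hg : Integrable g) :
    Integrable fun x => g (rescaleHomeomorph a hr.ne' x) := by
  have h2 := integrable_map_equiv (μ := volume)
    (rescaleHomeomorph a hr.ne').toMeasurableEquiv g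
  simp only [Homeomorph.toMeasurableEquiv_coe] at h2
  refine h2.mp ?_
  rw [map_rescale a hr]
  exact hg.smul_measure ENNReal.ofReal_ne_top

/-- The outer factor `r` cancels the `r⁻¹` of the chain rule, so gradient values are unchanged. The
proof moves the rescaling onto the test function. -/
theorem HasWeakGrad.rescale {d : ℕ} {f : EuclideanSpace ℝ (Fin m) → EuclideanSpace ℝ (Fin d)}
    {H : EuclideanSpace ℝ (Fin m) → Matrix (Fin d) (Fin m) ℝ} (h : HasWeakGrad f H)
    (a : EuclideanSpace ℝ (Fin m)) {r : ℝ} (hr : 0 < r) :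
    HasWeakGrad (fun x => r • f (rescaleHomeomorph a hr.ne' x))
      (fun x => H (rescaleHomeomorph a hr.ne' x)) := by
  refine ⟨(h.integrable.rescale a hr).smul r, fun i j => (h.integrable_grad i j).rescale a hr, ?_⟩
  intro φ hφ hφc i j
  set T := rescaleHomeomorph a hr.ne'
  set ψ : EuclideanSpace ℝ (Fin m) → ℝ := fun y => φ (r • y + a)
  have hψ : ContDiff ℝ ∞ ψ := hφ.comp ((contDiff_id.const_smul r).add contDiff_const)
  have hψT : ∀ x, φ x = ψ (T x) := fun x => by
    simp only [ψ, T, rescaleHomeomorph_apply, smul_smul, mul_inv_cancel₀ hr.ne', one_smul,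
      sub_add_cancel]
  have hψs : ψ = φ ∘ T.symm := by
    funext y
    simp only [Function.comp_apply, hψT, Homeomorph.apply_symm_apply]
  have hψc : HasCompactSupport ψ := by
    rw [hψs]; exact hφc.comp_homeomorph T.symm
  have hd : ∀ x v, r * fderiv ℝ φ x v = fderiv ℝ ψ (T x) v := fun x v => by
    have h1 : HasFDerivAt (fun y : EuclideanSpace ℝ (Fin m) => r • y + a)
        (r • ContinuousLinearMap.id ℝ _) (T x) :=
      ((hasFDerivAt_id (T x)).const_smul r).add_const a
    have h2 : r • T x + a = x := by
      simp only [T, rescaleHomeomorph_apply, smul_smul, mul_inv_cancel₀ hr.ne', one_smul,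
        sub_add_cancel]
    have h3 : HasFDerivAt φ (fderiv ℝ φ x) (r • T x + a) := by
      rw [h2]; exact (hφ.differentiable (by simp) x).hasFDerivAt
    have h4 : HasFDerivAt ψ _ (T x) := h3.comp (T x) h1
    rw [h4.fderiv]
    simp
  calc ∫ x, (r • f (T x)) i * fderiv ℝ φ x (EuclideanSpace.single j 1)
      = ∫ x, (fun y => f y i * fderiv ℝ ψ y (EuclideanSpace.single j 1)) (T x) := by
        congr 1; funext x
        simp only [← hd, PiLp.smul_apply, smul_eq_mul]
        ring
    _ = r ^ m * - ∫ x, H x i j * ψ x := by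
        rw [← h.integral_eq ψ hψ hψc i j]
        exact integral_rescale a hr fun y => f y i * fderiv ℝ ψ y (EuclideanSpace.single j 1)
    _ = - (r ^ m * ∫ x, H x i j * ψ x) := by ring
    _ = - ∫ x, (fun y => H y i j * ψ y) (T x) := by
        rw [← integral_rescale a hr fun x => H x i j * ψ x]
    _ = _ := by simp only [hψT]

end Rescale

/-! ### Cutoff functions and extension by zero from the ball -/

section Cutoff

variable {m : ℕ}

theorem deriv_smoothTransition_eq_zero {t : ℝ} (ht : t ∉ Icc (0 : ℝ) 1) :
    deriv Real.smoothTransition t = 0 := by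
  rw [mem_Icc, not_and_or, not_le, not_le] at ht
  have : Real.smoothTransition =ᶠ[𝓝 t] fun _ => Real.smoothTransition t := by
    rcases ht with ht | ht
    · filter_upwards [gt_mem_nhds ht] with s hs
      rw [Real.smoothTransition.zero_of_nonpos hs.le, Real.smoothTransition.zero_of_nonpos ht.le]
    · filter_upwards [lt_mem_nhds ht] with s hs
      rw [Real.smoothTransition.one_of_one_le hs.le, Real.smoothTransition.one_of_one_le ht.le]
  rw [this.deriv_eq, deriv_const]

theorem exists_bound_deriv_smoothTransition :
    ∃ C : ℝ, 0 ≤ C ∧ ∀ t, |deriv Real.smoothTransition t| ≤ C := by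
  have hc : Continuous (deriv Real.smoothTransition) :=
    (Real.smoothTransition.contDiff (n := 1)).continuous_deriv le_rfl
  have hcs : HasCompactSupport (deriv Real.smoothTransition) :=
    HasCompactSupport.intro isCompact_Icc fun t ht => deriv_smoothTransition_eq_zero ht
  obtain ⟨C, hC⟩ := hcs.exists_bound_of_continuous hc
  exact ⟨C, (norm_nonneg _).trans (hC 0), hC⟩

/-- A smooth radial cutoff function of the unit ball of `ℝ^m` which is `1` where
`|x|² ≤ 1 - 2 / N` and `0` where `|x|² ≥ 1 - 1 / N`. -/
noncomputable def ballCutoff (N : ℝ) (x : EuclideanSpace ℝ (Fin m)) : ℝ :=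
  Real.smoothTransition (N * (1 - ‖x‖ ^ 2) - 1)

theorem contDiff_ballCutoff (N : ℝ) :
    ContDiff ℝ ∞ (ballCutoff N : EuclideanSpace ℝ (Fin m) → ℝ) := by
  refine Real.smoothTransition.contDiff.comp ?_
  exact (contDiff_const.mul (contDiff_const.sub (contDiff_norm_sq ℝ))).sub contDiff_const

theorem fderiv_ballCutoff (N : ℝ) (x v : EuclideanSpace ℝ (Fin m)) :
    fderiv ℝ (ballCutoff N) x v =
      deriv Real.smoothTransition (N * (1 - ‖x‖ ^ 2) - 1) * (-2 * N * inner ℝ x v) := by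
  have h1 : HasFDerivAt (fun x : EuclideanSpace ℝ (Fin m) => N * (1 - ‖x‖ ^ 2) - 1)
      (N • (-(2 • innerSL ℝ x) : EuclideanSpace ℝ (Fin m) →L[ℝ] ℝ)) x :=
    (((hasStrictFDerivAt_norm_sq x).hasFDerivAt.const_sub 1).const_mul N).sub_const 1
  have h2 : HasDerivAt Real.smoothTransition
      (deriv Real.smoothTransition (N * (1 - ‖x‖ ^ 2) - 1)) (N * (1 - ‖x‖ ^ 2) - 1) :=
    ((Real.smoothTransition.contDiff (n := 1)).differentiable (by simp) _).hasDerivAt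
  have h3 : HasFDerivAt (ballCutoff N) _ x := h2.comp_hasFDerivAt x h1
  rw [h3.fderiv]
  simp only [smul_neg, smul_apply, neg_apply, smul_eq_mul, add_apply, innerSL_apply_apply, two_smul]
  ring

theorem ballCutoff_eq_zero {N : ℝ} {x : EuclideanSpace ℝ (Fin m)} (h : N * (1 - ‖x‖ ^ 2) ≤ 1) :
    ballCutoff N x = 0 :=
  Real.smoothTransition.zero_of_nonpos (by linarith)

theorem tsupport_ballCutoff_subset {N : ℝ} (hN : 0 < N) :
    tsupport (ballCutoff N : EuclideanSpace ℝ (Fin m) → ℝ) ⊆ Metric.ball 0 1 := by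
  have h1 : tsupport (ballCutoff N : EuclideanSpace ℝ (Fin m) → ℝ) ⊆
      {x | 1 ≤ N * (1 - ‖x‖ ^ 2)} := by
    refine closure_minimal (fun x hx => ?_) (isClosed_le (by fun_prop) (by fun_prop))
    by_contra hx2
    exact hx (ballCutoff_eq_zero (not_le.mp hx2).le)
  intro x hx
  have h2 : 1 ≤ N * (1 - ‖x‖ ^ 2) := h1 hx
  rw [mem_ball_zero_iff]
  by_contra h3
  have h4 : 1 - ‖x‖ ^ 2 ≤ 0 := by nlinarith [norm_nonneg x]
  nlinarith

theorem tendsto_ballCutoff {x : EuclideanSpace ℝ (Fin m)} (hx : x ∈ Metric.ball 0 1) :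
    Tendsto (fun n : ℕ => ballCutoff ((n : ℝ) + 3) x) atTop (𝓝 1) := by
  rw [mem_ball_zero_iff] at hx
  have h1 : 0 < 1 - ‖x‖ ^ 2 := by nlinarith [norm_nonneg x]
  have h2 : Tendsto (fun n : ℕ => ((n : ℝ) + 3) * (1 - ‖x‖ ^ 2) - 1) atTop atTop :=
    tendsto_atTop_add_const_right _ _
      ((tendsto_atTop_add_const_right _ _ tendsto_natCast_atTop_atTop).atTop_mul_const h1)
  refine tendsto_const_nhds.congr' ?_
  filter_upwards [h2.eventually_ge_atTop 1] with n hn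
  exact (Real.smoothTransition.one_of_one_le hn).symm

/-- Bernoulli's inequality `s ^ m ≥ 1 - m * (1 - s)`. A shell volume linear in its width compensates
for the gradient of the cutoff function, which is inversely proportional to that width. -/
theorem volume_real_shell_le {s : ℝ} (hs : 0 < s) (hs1 : s ≤ 1) :
    volume.real (Metric.ball (0 : EuclideanSpace ℝ (Fin m)) 1 \ Metric.ball 0 s) ≤
      m * (1 - s) * volume.real (Metric.ball (0 : EuclideanSpace ℝ (Fin m)) 1) := by
  rw [measureReal_sdiff (Metric.ball_subset_ball hs1) Metric.isOpen_ball.measurableSet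
    measure_ball_lt_top.ne]
  have h1 : volume.real (Metric.ball (0 : EuclideanSpace ℝ (Fin m)) s) =
      s ^ m * volume.real (Metric.ball (0 : EuclideanSpace ℝ (Fin m)) 1) := by
    rw [Measure.real, Measure.addHaar_ball_of_pos _ _ hs, ENNReal.toReal_mul,
      ENNReal.toReal_ofReal (by positivity), finrank_euclideanSpace_fin]
    rfl
  rw [h1]
  have h2 := one_add_mul_le_pow (a := s - 1) (by linarith) m
  rw [add_sub_cancel] at h2
  have := measureReal_nonneg (μ := volume) (s := Metric.ball (0 : EuclideanSpace ℝ (Fin m)) 1)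
  nlinarith

/-- The extension by zero of a map on the unit ball which vanishes continuously on the unit sphere
has a weak gradient, if the map has a weak gradient on the ball. -/
theorem hasWeakGrad_of_ball {d : ℕ} {f : EuclideanSpace ℝ (Fin m) → EuclideanSpace ℝ (Fin d)}
    {H : EuclideanSpace ℝ (Fin m) → Matrix (Fin d) (Fin m) ℝ} (hf : Continuous f)
    (hf0 : ∀ x ∉ Metric.ball (0 : EuclideanSpace ℝ (Fin m)) 1, f x = 0)
    (hH0 : ∀ x ∉ Metric.ball (0 : EuclideanSpace ℝ (Fin m)) 1, H x = 0)
    (hH : ∀ i j, Integrable (fun x => H x i j))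
    (h : ∀ φ : EuclideanSpace ℝ (Fin m) → ℝ, ContDiff ℝ ∞ φ → HasCompactSupport φ →
      tsupport φ ⊆ Metric.ball 0 1 → ∀ i j,
        ∫ x, f x i * fderiv ℝ φ x (EuclideanSpace.single j 1) = - ∫ x, H x i j * φ x) :
    HasWeakGrad f H := by
  have hfc : HasCompactSupport f :=
    HasCompactSupport.intro (isCompact_closedBall (0 : EuclideanSpace ℝ (Fin m)) 1)
      fun x hx => hf0 x fun hx' => hx (Metric.ball_subset_closedBall hx')
  have hfi : Integrable f := hf.integrable_of_hasCompactSupport hfc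
  refine ⟨hfi, hH, ?_⟩
  intro φ hφ hφc i j
  set v : EuclideanSpace ℝ (Fin m) := EuclideanSpace.single j 1
  have hv : ‖v‖ = 1 := by simp [v]
  have hfi' : Integrable fun x => f x i := (EuclideanSpace.proj (𝕜 := ℝ) i).integrable_comp hfi
  have hfci : Continuous fun x => f x i := (EuclideanSpace.proj (𝕜 := ℝ) i).continuous.comp hf
  have hdc : Continuous fun x => fderiv ℝ φ x v := contDiff_fderiv_apply hφ v
  obtain ⟨C₁, hC₁⟩ := hφc.exists_bound_of_continuous hφ.continuous
  have hC₁0 : 0 ≤ C₁ := (norm_nonneg _).trans (hC₁ 0)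
  obtain ⟨C₂, hC₂⟩ := (hφc.fderiv_apply ℝ v).exists_bound_of_continuous hdc
  obtain ⟨C₃, hC₃0, hC₃⟩ := exists_bound_deriv_smoothTransition
  set ψ : ℕ → EuclideanSpace ℝ (Fin m) → ℝ := fun n => ballCutoff ((n : ℝ) + 3)
  have hψ : ∀ n, ContDiff ℝ ∞ (ψ n) := fun n => contDiff_ballCutoff _
  have hψ1 : ∀ n x, ‖ψ n x‖ ≤ 1 := fun n x => by
    refine (Real.norm_of_nonneg (Real.smoothTransition.nonneg _)).trans_le ?_
    exact Real.smoothTransition.le_one _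
  have i1 : Integrable fun x => f x i * fderiv ℝ φ x v :=
    hfi'.mul_bdd hdc.aestronglyMeasurable (Eventually.of_forall hC₂)
  have i2 : Integrable fun x => H x i j * φ x :=
    (hH i j).mul_bdd hφ.continuous.aestronglyMeasurable (Eventually.of_forall hC₁)
  have t1 : Tendsto (fun n => ∫ x, f x i * fderiv ℝ φ x v * ψ n x) atTop
      (𝓝 (∫ x, f x i * fderiv ℝ φ x v)) := by
    refine tendsto_integral_of_dominated_convergence (fun x => ‖f x i * fderiv ℝ φ x v‖)
      (fun n => i1.1.mul (hψ n).continuous.aestronglyMeasurable) i1.norm ?_ ?_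
    · refine fun n => Eventually.of_forall fun x => ?_
      rw [norm_mul]
      exact mul_le_of_le_one_right (norm_nonneg _) (hψ1 n x)
    · refine Eventually.of_forall fun x => ?_
      by_cases hx : x ∈ Metric.ball (0 : EuclideanSpace ℝ (Fin m)) 1
      · simpa using (tendsto_ballCutoff hx).const_mul (f x i * fderiv ℝ φ x v)
      · simp [hf0 x hx]
  have t2 : Tendsto (fun n => ∫ x, H x i j * φ x * ψ n x) atTop (𝓝 (∫ x, H x i j * φ x)) := by
    refine tendsto_integral_of_dominated_convergence (fun x => ‖H x i j * φ x‖)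
      (fun n => i2.1.mul (hψ n).continuous.aestronglyMeasurable) i2.norm ?_ ?_
    · refine fun n => Eventually.of_forall fun x => ?_
      rw [norm_mul]
      exact mul_le_of_le_one_right (norm_nonneg _) (hψ1 n x)
    · refine Eventually.of_forall fun x => ?_
      by_cases hx : x ∈ Metric.ball (0 : EuclideanSpace ℝ (Fin m)) 1
      · simpa using (tendsto_ballCutoff hx).const_mul (H x i j * φ x)
      · simp [hH0 x hx]
  -- The term where the derivative falls on the cutoff. That derivative is at most `C₃ * (2 * N)`
  -- and lives on a shell of volume at most `m * (2 / N) * V`, so the powers of `N` cancel. What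
  -- tends to zero is `f` near the sphere; hence the constant `4` in `A`.
  have t3 : Tendsto (fun n => ∫ x, f x i * φ x * fderiv ℝ (ψ n) x v) atTop (𝓝 0) := by
    set V := volume.real (Metric.ball (0 : EuclideanSpace ℝ (Fin m)) 1)
    have hV : 0 ≤ V := measureReal_nonneg
    set A := C₁ * C₃ * 4 * m * V
    have hA : 0 ≤ A := by positivity
    rw [Metric.tendsto_atTop]
    intro ε hε
    obtain ⟨ρ, hρ, hunif⟩ := Metric.uniformContinuous_iff.mp
      (hfc.uniformContinuous_of_continuous hf) (ε / (A + 1)) (by positivity)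
    obtain ⟨n₀, hn₀⟩ := exists_nat_gt (2 / ρ)
    refine ⟨n₀, fun n hn => ?_⟩
    set N : ℝ := (n : ℝ) + 3
    have hN3 : 3 ≤ N := by simp [N]
    have hN : 0 < N := by linarith
    have hNρ : 2 / N < ρ := by
      have : (n₀ : ℝ) ≤ n := by exact_mod_cast hn
      rw [div_lt_comm₀ hN hρ]
      linarith
    set s : ℝ := 1 - 2 / N
    have hs0 : 0 < s := by
      have : 2 / N < 1 := by rw [div_lt_one hN]; linarith
      linarith
    have hs1 : s ≤ 1 := by
      have : 0 < 2 / N := by positivity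
      linarith
    set S := Metric.ball (0 : EuclideanSpace ℝ (Fin m)) 1 \ Metric.ball 0 s
    have hout : ∀ x ∉ S, f x i * φ x * fderiv ℝ (ψ n) x v = 0 := by
      intro x hx
      by_cases hx1 : x ∈ Metric.ball (0 : EuclideanSpace ℝ (Fin m)) 1
      · have hxs : ‖x‖ < s := by
          by_contra hxs
          exact hx ⟨hx1, fun h => hxs (mem_ball_zero_iff.mp h)⟩
        rw [fderiv_ballCutoff, deriv_smoothTransition_eq_zero]
        · ring
        · rintro ⟨-, h2⟩
          have h3 : ‖x‖ ^ 2 < s := by nlinarith [norm_nonneg x]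
          have h4 : N * (1 - s) = 2 := by
            simp only [s]; field_simp; ring
          nlinarith
      · simp [hf0 x hx1]
    have hin : ∀ x ∈ S, ‖f x i * φ x * fderiv ℝ (ψ n) x v‖ ≤
        ε / (A + 1) * C₁ * (C₃ * (2 * N)) := by
      rintro x ⟨hx1, hxs⟩
      rw [mem_ball_zero_iff] at hx1 hxs
      have hx0 : 0 < ‖x‖ := hs0.trans_le (not_lt.mp hxs)
      have hfx : ‖f x i‖ ≤ ε / (A + 1) := by
        -- The radial projection of `x` lies on the sphere, where `f` vanishes, and its distance `1
        -- - ‖x‖ ≤ 2 / N < ρ` from `x` lets uniform continuity apply.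
        have hz : f (‖x‖⁻¹ • x) = 0 := by
          apply hf0
          rw [mem_ball_zero_iff, norm_smul, norm_inv, norm_norm, inv_mul_cancel₀ hx0.ne']
          exact lt_irrefl _
        have hdist : dist x (‖x‖⁻¹ • x) < ρ := by
          have : x - ‖x‖⁻¹ • x = (1 - ‖x‖⁻¹) • x := by rw [sub_smul, one_smul]
          rw [dist_eq_norm, this, norm_smul, ← norm_norm x, ← norm_mul, sub_mul, norm_norm,
            inv_mul_cancel₀ hx0.ne', one_mul, Real.norm_eq_abs, abs_of_nonpos (by linarith)]
          linarith [not_lt.mp hxs]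
        have := hunif hdist
        rw [hz, dist_zero_right] at this
        exact (PiLp.norm_apply_le (f x) i).trans this.le
      have hinner : |inner ℝ x v| ≤ 1 := by
        refine (abs_real_inner_le_norm x v).trans ?_
        rw [hv, mul_one]; exact hx1.le
      rw [norm_mul, norm_mul, fderiv_ballCutoff, norm_mul]
      gcongr
      · exact hC₁ x
      · exact hC₃ _
      · rw [norm_mul, Real.norm_eq_abs, Real.norm_eq_abs, abs_mul, abs_neg, abs_two, abs_of_pos hN]
        exact mul_le_of_le_one_right (by positivity) hinner
    rw [dist_zero_right, ← setIntegral_eq_integral_of_forall_compl_eq_zero hout]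
    have hSfin : volume S < ⊤ := (measure_mono sdiff_subset).trans_lt measure_ball_lt_top
    refine (norm_setIntegral_le_of_norm_le_const hSfin hin).trans_lt ?_
    have hS := volume_real_shell_le (m := m) hs0 hs1
    calc ε / (A + 1) * C₁ * (C₃ * (2 * N)) * volume.real S
        ≤ ε / (A + 1) * C₁ * (C₃ * (2 * N)) * (m * (1 - s) * V) := by gcongr
      _ = ε / (A + 1) * A := by
        simp only [A, s]; field_simp; ring
      _ < ε := by
        rw [div_mul_eq_mul_div, div_lt_iff₀ (by positivity)]
        nlinarith
  -- The hypothesis on the ball is applied to the compactly supported product `φ * ψ n`, and the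
  -- product rule separates the two derivatives.
  have heq : ∀ n, ∫ x, f x i * fderiv ℝ φ x v * ψ n x =
      - (∫ x, H x i j * φ x * ψ n x) - ∫ x, f x i * φ x * fderiv ℝ (ψ n) x v := by
    intro n
    have hψd : ∀ x, DifferentiableAt ℝ (ψ n) x := (hψ n).differentiable (by simp)
    have hφd : ∀ x, DifferentiableAt ℝ φ x := hφ.differentiable (by simp)
    have := h (fun x => φ x * ψ n x) (hφ.mul (hψ n)) hφc.mul_right
      ((tsupport_mul_subset_right).trans (tsupport_ballCutoff_subset (by positivity))) i j
    have e : ∀ x, f x i * fderiv ℝ (fun x => φ x * ψ n x) x v =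
        f x i * fderiv ℝ φ x v * ψ n x + f x i * φ x * fderiv ℝ (ψ n) x v := fun x => by
      rw [fderiv_fun_mul (hφd x) (hψd x)]
      simp
      ring
    have j1 : Integrable fun x => f x i * fderiv ℝ φ x v * ψ n x :=
      i1.mul_bdd (hψ n).continuous.aestronglyMeasurable (Eventually.of_forall (hψ1 n))
    have j2 : Integrable fun x => f x i * φ x * fderiv ℝ (ψ n) x v :=
      ((hfci.mul hφ.continuous).mul (contDiff_fderiv_apply (hψ n) v)).integrable_of_hasCompactSupport
        (hφc.mul_left.mul_right)
    change ∫ x, f x i * fderiv ℝ (fun x => φ x * ψ n x) x v = _ at this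
    simp only [e] at this
    rw [integral_add j1 j2] at this
    simp only [mul_assoc] at this ⊢
    linarith
  have := (t2.neg.sub t3)
  rw [sub_zero] at this
  exact tendsto_nhds_unique (t1.congr heq) this

end Cutoff

/-! ### Matrix norms and locally constant functions -/

section MatNorm

variable {d m : ℕ}

theorem matNorm_nonneg (X : Matrix (Fin d) (Fin m) ℝ) : 0 ≤ matNorm X := Real.sqrt_nonneg _

theorem abs_apply_le_matNorm (X : Matrix (Fin d) (Fin m) ℝ) (i : Fin d) (j : Fin m) :
    |X i j| ≤ matNorm X := by
  refine Real.abs_le_sqrt ?_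
  have h1 : X i j ^ 2 ≤ ∑ j, X i j ^ 2 :=
    Finset.single_le_sum (f := fun j => X i j ^ 2) (fun _ _ => sq_nonneg _) (Finset.mem_univ j)
  exact h1.trans (Finset.single_le_sum (f := fun i => ∑ j, X i j ^ 2)
    (fun _ _ => Finset.sum_nonneg fun _ _ => sq_nonneg _) (Finset.mem_univ i))

/-- The weight `(1 + |X|)^p`. -/
noncomputable def gradWeight (p : ℝ) (X : Matrix (Fin d) (Fin m) ℝ) : ℝ≥0∞ :=
  ENNReal.ofReal ((1 + matNorm X) ^ p)

theorem ofReal_one_add_matNorm_le_gradWeight {p : ℝ} (hp : 1 ≤ p)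
    (X : Matrix (Fin d) (Fin m) ℝ) : ENNReal.ofReal (1 + matNorm X) ≤ gradWeight p X := by
  refine ENNReal.ofReal_le_ofReal ?_
  have := matNorm_nonneg X
  calc 1 + matNorm X = (1 + matNorm X) ^ (1 : ℝ) := (Real.rpow_one _).symm
    _ ≤ _ := Real.rpow_le_rpow_of_exponent_le (by linarith) hp

theorem one_le_gradWeight {p : ℝ} (hp : 1 ≤ p) (X : Matrix (Fin d) (Fin m) ℝ) :
    1 ≤ gradWeight p X := by
  refine le_trans ?_ (ofReal_one_add_matNorm_le_gradWeight hp X)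
  rw [← ENNReal.ofReal_one]
  exact ENNReal.ofReal_le_ofReal (by linarith [matNorm_nonneg X])

theorem volume_le_setLIntegral_gradWeight {p : ℝ} (hp : 1 ≤ p)
    (G : EuclideanSpace ℝ (Fin m) → Matrix (Fin d) (Fin m) ℝ)
    (D : Set (EuclideanSpace ℝ (Fin m))) :
    volume D ≤ ∫⁻ x in D, gradWeight p (G x) := by
  calc volume D = ∫⁻ _ in D, 1 := (setLIntegral_one D).symm
    _ ≤ _ := lintegral_mono fun x => one_le_gradWeight hp (G x)

end MatNorm

section LocallyConstant

variable {X Y : Type*} [TopologicalSpace X] {V : Set X} {L : X → Y}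

theorem isOpen_sep_of_eventually_eq (hV : IsOpen V) (hL : ∀ x ∈ V, ∀ᶠ y in 𝓝 x, L y = L x)
    (P : Y → Prop) : IsOpen {x ∈ V | P (L x)} := by
  refine isOpen_iff_mem_nhds.mpr ?_
  rintro x ⟨hxV, hx⟩
  filter_upwards [hV.mem_nhds hxV, hL x hxV] with y hyV hy
  exact ⟨hyV, by rwa [hy]⟩

theorem continuousOn_of_eventually_eq [TopologicalSpace Y]
    (hL : ∀ x ∈ V, ∀ᶠ y in 𝓝 x, L y = L x) : ContinuousOn L V := fun x hx =>
  (continuousAt_const.congr (EventuallyEq.symm (hL x hx))).continuousWithinAt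

end LocallyConstant

/-- `f` with gradient `H` is a correction, supported in `D`, of a map whose gradient is `G`. The
gradient `G + H` of the corrected map lies in `K ∪ U`, its part outside `K` is small, and it
satisfies weak `L^p` bounds. All maps involved are locally affine on the set `V` of full measure
in `D`. -/
structure IsCorrection {d m : ℕ} (U K : Set (Matrix (Fin d) (Fin m) ℝ)) (p M c₀ ε : ℝ) (α : ℝ≥0)
    (η : ℝ) (D V : Set (EuclideanSpace ℝ (Fin m)))
    (G : EuclideanSpace ℝ (Fin m) → Matrix (Fin d) (Fin m) ℝ)
    (f : EuclideanSpace ℝ (Fin m) → EuclideanSpace ℝ (Fin d))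
    (H : EuclideanSpace ℝ (Fin m) → Matrix (Fin d) (Fin m) ℝ) : Prop where
  isOpen : IsOpen V
  subset : V ⊆ D
  volume_sdiff : volume (D \ V) = 0
  map_eq_zero : ∀ x ∉ D, f x = 0
  grad_eq_zero : ∀ x ∉ D, H x = 0
  hasWeakGrad : HasWeakGrad f H
  bound : ∀ x, ‖f x‖ ≤ η
  holder : ∀ x y, ‖f x - f y‖ ≤ η * dist x y ^ (α : ℝ)
  affineNear : ∀ x ∈ V, AffineNear f H x
  mem : ∀ x ∈ V, G x + H x ∉ K → G x + H x ∈ U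
  error : ∫⁻ x in {x ∈ V | G x + H x ∉ K}, gradWeight p (G x + H x) ≤
    ENNReal.ofReal ε * volume D
  upper : ∀ t : ℝ, 0 < t → volume {x ∈ V | t < matNorm (G x + H x)} ≤
    ENNReal.ofReal (M ^ p * t ^ (-p)) * ∫⁻ x in D, gradWeight p (G x)
  lower : ∀ t : ℝ, 1 < t → ENNReal.ofReal (c₀ ^ p * t ^ (-p)) * volume D ≤
    volume {x ∈ V | t < matNorm (G x + H x)}

/-! ### Corrections: integrability and scaling -/

namespace IsCorrection

variable {d m : ℕ} {U K : Set (Matrix (Fin d) (Fin m) ℝ)} {p M c₀ ε : ℝ} {α : ℝ≥0} {η : ℝ}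
  {D V : Set (EuclideanSpace ℝ (Fin m))}
  {G : EuclideanSpace ℝ (Fin m) → Matrix (Fin d) (Fin m) ℝ}
  {f : EuclideanSpace ℝ (Fin m) → EuclideanSpace ℝ (Fin d)}
  {H : EuclideanSpace ℝ (Fin m) → Matrix (Fin d) (Fin m) ℝ}

theorem eventually_add_eq (h : IsCorrection U K p M c₀ ε α η D V G f H)
    (hG : ∀ x ∈ D, ∀ᶠ y in 𝓝 x, G y = G x) :
    ∀ x ∈ V, ∀ᶠ y in 𝓝 x, G y + H y = G x + H x := by
  intro x hx
  filter_upwards [hG x (h.subset hx), h.affineNear x hx] with y hy hy'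
  rw [hy, hy'.2]

/-- Only the values of the gradient on `D` enter. This lets a correction built for a constant
gradient be used on a ball where `G` takes that constant value. -/
theorem congr_grad {G' : EuclideanSpace ℝ (Fin m) → Matrix (Fin d) (Fin m) ℝ}
    (h : IsCorrection U K p M c₀ ε α η D V G f H) (hD : MeasurableSet D)
    (hG : ∀ x ∈ D, G' x = G x) : IsCorrection U K p M c₀ ε α η D V G' f H := by
  have hs : ∀ P : Matrix (Fin d) (Fin m) ℝ → Prop,
      {x ∈ V | P (G' x + H x)} = {x ∈ V | P (G x + H x)} := by
    intro P
    ext x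
    simp only [mem_ofPred_eq, and_congr_right_iff]
    intro hx
    rw [hG x (h.subset hx)]
  refine { h with mem := ?_, error := ?_, upper := ?_, lower := ?_ }
  · intro x hx
    rw [hG x (h.subset hx)]
    exact h.mem x hx
  · rw [hs fun X => X ∉ K]
    refine le_trans (lintegral_mono_ae ?_) h.error
    have : volume.restrict {x ∈ V | G x + H x ∉ K} ≤ volume.restrict D :=
      Measure.restrict_mono (fun x hx => h.subset hx.1) le_rfl
    refine ae_mono this ?_
    filter_upwards [ae_restrict_mem hD] with x hx
    rw [hG x hx]
  · intro t ht
    rw [hs fun X => t < matNorm X]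
    refine (h.upper t ht).trans (le_of_eq ?_)
    congr 1
    exact setLIntegral_congr_fun hD fun x hx => by rw [hG x hx]
  · intro t ht
    rw [hs fun X => t < matNorm X]
    exact h.lower t ht

/-- A weak `L^p` bound with `p > 1` controls the `L^1` norm by the layer cake formula. The constant
collects one integral from `G` itself, one from the levels `t ≤ 1`, and `M ^ p / (p - 1)` from the
levels `t > 1`. Being linear in the weighted integral over `D`, the bound can be summed over pieces
and over steps. -/
theorem lintegral_enorm_grad_le (h : IsCorrection U K p M c₀ ε α η D V G f H) (hp : 1 < p)
    (hM : 0 ≤ M) (hG : ∀ x ∈ D, ∀ᶠ y in 𝓝 x, G y = G x) (i : Fin d) (j : Fin m) :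
    ∫⁻ x, ‖H x i j‖ₑ ≤
      ENNReal.ofReal (2 + M ^ p / (p - 1)) * ∫⁻ x in D, gradWeight p (G x) := by
  set I := ∫⁻ x in D, gradWeight p (G x) with hI
  have hMp : 0 ≤ M ^ p := Real.rpow_nonneg hM p
  have hvol : volume V ≤ I :=
    (measure_mono h.subset).trans (volume_le_setLIntegral_gradWeight hp.le G D)
  have hV : ∫⁻ x, ‖H x i j‖ₑ = ∫⁻ x in V, ‖H x i j‖ₑ := by
    rw [← lintegral_indicator h.isOpen.measurableSet]
    refine lintegral_congr_ae ?_
    filter_upwards [measure_eq_zero_iff_ae_notMem.mp h.volume_sdiff] with x hx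
    by_cases hxV : x ∈ V
    · rw [indicator_of_mem hxV]
    · rw [indicator_of_notMem hxV, h.grad_eq_zero x fun hxD => hx ⟨hxD, hxV⟩]
      simp
  have hcont : ContinuousOn (fun x => matNorm (G x + H x)) V := by
    refine continuousOn_of_eventually_eq fun x hx => ?_
    filter_upwards [h.eventually_add_eq hG x hx] with y hy
    rw [hy]
  have hcont' : ContinuousOn (fun x => matNorm (G x)) V := by
    refine continuousOn_of_eventually_eq fun x hx => ?_
    filter_upwards [hG x (h.subset hx)] with y hy
    rw [hy]
  have hle : ∀ x, ‖H x i j‖ₑ ≤ ENNReal.ofReal (matNorm (G x + H x)) +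
      ENNReal.ofReal (matNorm (G x)) := by
    intro x
    rw [← ENNReal.ofReal_add (matNorm_nonneg _) (matNorm_nonneg _), ← ofReal_norm]
    refine ENNReal.ofReal_le_ofReal ?_
    have e : H x i j = (G x + H x) i j - G x i j := by simp
    rw [e]
    exact (norm_sub_le _ _).trans
      (add_le_add (abs_apply_le_matNorm _ i j) (abs_apply_le_matNorm _ i j))
  have h1 : ∫⁻ x in V, ENNReal.ofReal (matNorm (G x)) ≤ I := by
    refine (lintegral_mono fun x => ?_).trans (lintegral_mono_set h.subset)
    refine le_trans (ENNReal.ofReal_le_ofReal ?_) (ofReal_one_add_matNorm_le_gradWeight hp.le _)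
    linarith
  have h2 : ∫⁻ x in V, ENNReal.ofReal (matNorm (G x + H x)) ≤
      I + ENNReal.ofReal (M ^ p / (p - 1)) * I := by
    rw [lintegral_eq_lintegral_meas_lt _ (Eventually.of_forall fun x => matNorm_nonneg _)
      (hcont.aemeasurable h.isOpen.measurableSet)]
    -- For `t ≤ 1` the superlevel set is bounded trivially by the volume of `V`; for `t > 1` the
    -- weak bound is integrable.
    have hsplit : Ioi (0 : ℝ) = Ioc 0 1 ∪ Ioi 1 := (Ioc_union_Ioi_eq_Ioi zero_le_one).symm
    rw [hsplit]
    refine (lintegral_union_le _ _ _).trans (add_le_add ?_ ?_)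
    · calc ∫⁻ t in Ioc (0 : ℝ) 1, volume.restrict V {a | t < matNorm (G a + H a)}
          ≤ ∫⁻ t in Ioc (0 : ℝ) 1, I := lintegral_mono fun t =>
            (measure_mono (subset_univ _)).trans (by rwa [Measure.restrict_apply_univ])
        _ = I := by simp
    · calc ∫⁻ t in Ioi (1 : ℝ), volume.restrict V {a | t < matNorm (G a + H a)}
          ≤ ∫⁻ t in Ioi (1 : ℝ), ENNReal.ofReal (M ^ p * t ^ (-p)) * I := by
            refine setLIntegral_mono' measurableSet_Ioi fun t ht => ?_
            refine le_trans (le_of_eq ?_) (h.upper t (zero_lt_one.trans ht))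
            rw [Measure.restrict_apply' h.isOpen.measurableSet]
            congr 1
            ext x
            exact and_comm
        _ = (∫⁻ t in Ioi (1 : ℝ), ENNReal.ofReal (M ^ p * t ^ (-p))) * I := by
            refine lintegral_mul_const _ ?_
            fun_prop
        _ = ENNReal.ofReal (M ^ p / (p - 1)) * I := by
            congr 1
            rw [← ofReal_integral_eq_lintegral_ofReal]
            · rw [integral_const_mul, integral_Ioi_rpow_of_lt (by linarith) one_pos, Real.one_rpow]
              congr 1
              have : p - 1 ≠ 0 := by linarith
              have : -p + 1 ≠ 0 := by linarith
              field_simp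
              ring
            · exact (integrableOn_Ioi_rpow_of_lt (by linarith) one_pos).const_mul _
            · filter_upwards [ae_restrict_mem measurableSet_Ioi] with t ht
              exact mul_nonneg hMp (Real.rpow_nonneg (zero_le_one.trans (le_of_lt ht)) _)
  calc ∫⁻ x, ‖H x i j‖ₑ = ∫⁻ x in V, ‖H x i j‖ₑ := hV
    _ ≤ ∫⁻ x in V, (ENNReal.ofReal (matNorm (G x + H x)) + ENNReal.ofReal (matNorm (G x))) :=
        lintegral_mono hle
    _ = (∫⁻ x in V, ENNReal.ofReal (matNorm (G x + H x))) +
          ∫⁻ x in V, ENNReal.ofReal (matNorm (G x)) :=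
        lintegral_add_right' _ (hcont'.aemeasurable h.isOpen.measurableSet).ennreal_ofReal
    _ ≤ (I + ENNReal.ofReal (M ^ p / (p - 1)) * I) + I := add_le_add h2 h1
    _ = ENNReal.ofReal (2 + M ^ p / (p - 1)) * I := by
        rw [ENNReal.ofReal_add zero_le_two (div_nonneg hMp (by linarith)), ENNReal.ofReal_ofNat]
        ring

/-- All volumes and integrals scale by the same factor `r ^ m`, so the measure estimates persist
with unchanged constants. The Hölder seminorm gains `r ^ (1 - α)`, and `r ≤ 1` gives `r ≤ r ^ (1 -
α)`, so one factor serves for the sup norm too. -/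
theorem rescale {X : Matrix (Fin d) (Fin m) ℝ} {C r : ℝ}
    (h : IsCorrection U K p M c₀ ε α C (Metric.ball 0 1) V (fun _ => X) f H)
    (a : EuclideanSpace ℝ (Fin m)) (hr : 0 < r) (hr1 : r ≤ 1)
    (hη : C * r ^ (1 - α : ℝ) ≤ η) :
    IsCorrection U K p M c₀ ε α η (Metric.ball a r) (rescaleHomeomorph a hr.ne' ⁻¹' V)
      (fun _ => X) (fun x => r • f (rescaleHomeomorph a hr.ne' x))
      (fun x => H (rescaleHomeomorph a hr.ne' x)) := by
  have hball : rescaleHomeomorph a hr.ne' ⁻¹' Metric.ball 0 1 = Metric.ball a r := by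
    ext x
    rw [mem_preimage, rescaleHomeomorph_apply, mem_ball_zero_iff, norm_smul, mem_ball_iff_norm,
      norm_inv, Real.norm_of_nonneg hr.le, inv_mul_lt_iff₀ hr, mul_one]
  have hC : 0 ≤ C := (norm_nonneg _).trans (h.bound 0)
  rw [← hball]
  set T := rescaleHomeomorph a hr.ne'
  refine ⟨h.isOpen.preimage T.continuous, preimage_mono h.subset, ?_, ?_, ?_,
    h.hasWeakGrad.rescale a hr, ?_, ?_, ?_, ?_, ?_, ?_, ?_⟩
  · rw [← preimage_sdiff, measure_preimage_rescale a hr, h.volume_sdiff, mul_zero]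
  · intro x hx
    rw [h.map_eq_zero _ hx, smul_zero]
  · intro x hx
    exact h.grad_eq_zero _ hx
  · intro x
    rw [norm_smul, Real.norm_of_nonneg hr.le]
    calc r * ‖f (T x)‖ ≤ r ^ (1 - α : ℝ) * C := by
          gcongr
          · calc r = r ^ (1 : ℝ) := (Real.rpow_one r).symm
              _ ≤ _ := Real.rpow_le_rpow_of_exponent_ge hr hr1 (by simp)
          · exact h.bound _
      _ ≤ η := by rwa [mul_comm]
  · intro x y
    have hd : dist (T x) (T y) = r⁻¹ * dist x y := by
      simp only [T, rescaleHomeomorph_apply]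
      rw [dist_smul₀, dist_sub_right, norm_inv, Real.norm_of_nonneg hr.le]
    rw [← smul_sub, norm_smul, Real.norm_of_nonneg hr.le]
    calc r * ‖f (T x) - f (T y)‖ ≤ r * (C * (r⁻¹ * dist x y) ^ (α : ℝ)) := by
          gcongr
          rw [← hd]
          exact h.holder _ _
      _ = C * r ^ (1 - α : ℝ) * dist x y ^ (α : ℝ) := by
          rw [Real.mul_rpow (by positivity) dist_nonneg, Real.rpow_sub hr, Real.rpow_one,
            Real.inv_rpow hr.le]
          ring
      _ ≤ η * dist x y ^ (α : ℝ) := by gcongr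
  · exact fun x hx => (h.affineNear _ hx).rescale a hr.ne'
  · exact fun x hx => h.mem _ hx
  · have e : {x ∈ T ⁻¹' V | X + H (T x) ∉ K} = T ⁻¹' {y ∈ V | X + H y ∉ K} := rfl
    have := setLIntegral_rescale a hr {y ∈ V | X + H y ∉ K} fun y => gradWeight p (X + H y)
    rw [e, this, measure_preimage_rescale a hr, mul_left_comm]
    gcongr
    exact h.error
  · intro t ht
    have e : {x ∈ T ⁻¹' V | t < matNorm (X + H (T x))} = T ⁻¹' {y ∈ V | t < matNorm (X + H y)} :=
      rfl
    rw [e, measure_preimage_rescale a hr, setLIntegral_const, measure_preimage_rescale a hr]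
    have := h.upper t ht
    rw [setLIntegral_const] at this
    calc _ ≤ ENNReal.ofReal (r ^ m) * _ := mul_le_mul_right this _
      _ = _ := by ring
  · intro t ht
    have e : {x ∈ T ⁻¹' V | t < matNorm (X + H (T x))} = T ⁻¹' {y ∈ V | t < matNorm (X + H y)} :=
      rfl
    rw [e, measure_preimage_rescale a hr, measure_preimage_rescale a hr, mul_left_comm]
    gcongr
    exact h.lower t ht

end IsCorrection

/-! ### Hölder estimates and extension by zero -/

section Holder

variable {d m : ℕ} {α : ℝ≥0}

theorem exists_holder_affMap (hα : α ≤ 1) (X : Matrix (Fin d) (Fin m) ℝ)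
    (b : EuclideanSpace ℝ (Fin d)) {A : Set (EuclideanSpace ℝ (Fin m))}
    (hA : Bornology.IsBounded A) :
    ∃ C : ℝ, 0 ≤ C ∧ (∀ x ∈ A, ‖affMap X b x‖ ≤ C) ∧
      ∀ x ∈ A, ∀ y ∈ A, ‖affMap X b x - affMap X b y‖ ≤ C * dist x y ^ (α : ℝ) := by
  set L := LinearMap.toContinuousLinearMap (Matrix.toEuclideanLin X)
  have hL : ∀ x, Matrix.toEuclideanLin X x = L x := fun _ => rfl
  obtain ⟨R, hR⟩ := hA.exists_norm_le
  set R' := max R 0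
  have hR' : ∀ x ∈ A, ‖x‖ ≤ R' := fun x hx => (hR x hx).trans (le_max_left _ _)
  have hR0 : 0 ≤ R' := le_max_right _ _
  refine ⟨max (‖L‖ * R' + ‖b‖) (‖L‖ * (2 * R') ^ (1 - α : ℝ)),
    le_max_of_le_left (by positivity), ?_, ?_⟩
  · intro x hx
    refine le_max_of_le_left ?_
    rw [affMap, hL]
    refine (norm_add_le _ _).trans ?_
    gcongr
    exact (L.le_opNorm x).trans (by gcongr; exact hR' x hx)
  · intro x hx y hy
    have hxy : dist x y ≤ 2 * R' := by
      rw [dist_eq_norm]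
      linarith [norm_sub_le x y, hR' x hx, hR' y hy]
    have hα' : (0 : ℝ) ≤ 1 - α := sub_nonneg.mpr (by exact_mod_cast hα)
    calc ‖affMap X b x - affMap X b y‖ = ‖L (x - y)‖ := by
          simp only [affMap, hL, map_sub, add_sub_add_right_eq_sub]
      _ ≤ ‖L‖ * dist x y := by rw [dist_eq_norm]; exact L.le_opNorm _
      _ = ‖L‖ * (dist x y ^ (1 - α : ℝ) * dist x y ^ (α : ℝ)) := by
          rw [← Real.rpow_add' dist_nonneg (by simp), sub_add_cancel, Real.rpow_one]
      _ ≤ ‖L‖ * ((2 * R') ^ (1 - α : ℝ) * dist x y ^ (α : ℝ)) := by gcongr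
      _ = ‖L‖ * (2 * R') ^ (1 - α : ℝ) * dist x y ^ (α : ℝ) := by ring
      _ ≤ _ := by gcongr; exact le_max_right _ _

theorem exists_holder_of_holderENorm_lt_top {A : Set (EuclideanSpace ℝ (Fin m))}
    {w : EuclideanSpace ℝ (Fin m) → EuclideanSpace ℝ (Fin d)} (hw : holderENorm α A w < ⊤) :
    ∃ C : ℝ, 0 ≤ C ∧ (∀ x ∈ A, ‖w x‖ ≤ C) ∧
      ∀ x ∈ A, ∀ y ∈ A, ‖w x - w y‖ ≤ C * dist x y ^ (α : ℝ) := by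
  obtain ⟨h1, h2⟩ := ENNReal.add_lt_top.mp hw
  obtain ⟨C, hC⟩ := eHolderNorm_lt_top.mp h2
  set C₁ := (⨆ x ∈ A, ‖w x‖ₑ).toReal
  refine ⟨max C₁ C, le_max_of_le_left ENNReal.toReal_nonneg, ?_, ?_⟩
  · intro x hx
    refine le_max_of_le_left ?_
    rw [← toReal_enorm]
    exact ENNReal.toReal_mono h1.ne (le_biSup (fun x => ‖w x‖ₑ) hx)
  · intro x hx y hy
    have := hC.dist_le ⟨x, hx⟩ ⟨y, hy⟩
    rw [dist_eq_norm] at this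
    refine this.trans ?_
    change (C : ℝ) * dist x y ^ (α : ℝ) ≤ _
    gcongr
    exact le_max_right _ _

theorem holderENorm_le {A : Set (EuclideanSpace ℝ (Fin m))}
    {w : EuclideanSpace ℝ (Fin m) → EuclideanSpace ℝ (Fin d)} {C : ℝ}
    (h1 : ∀ x ∈ A, ‖w x‖ ≤ C)
    (h2 : ∀ x ∈ A, ∀ y ∈ A, ‖w x - w y‖ ≤ C * dist x y ^ (α : ℝ)) :
    holderENorm α A w ≤ ENNReal.ofReal C + ENNReal.ofReal C := by
  refine add_le_add ?_ ?_
  · refine iSup₂_le fun x hx => ?_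
    rw [← ofReal_norm]
    exact ENNReal.ofReal_le_ofReal (h1 x hx)
  · have hH : HolderWith C.toNNReal α (A.domRestrict w) := by
      rintro ⟨x, hx⟩ ⟨y, hy⟩
      have := ENNReal.ofReal_le_ofReal (h2 x hx y hy)
      rw [← dist_eq_norm, ← edist_dist, ENNReal.ofReal_mul' (by positivity),
        ← ENNReal.ofReal_rpow_of_nonneg dist_nonneg α.coe_nonneg, ← edist_dist] at this
      exact this
    exact hH.eHolderNorm_le

/-- The segment from `x` to `y` crosses the unit sphere, and the crossing point is no farther from
`x` than `y` is. -/
theorem exists_norm_eq_one_dist_le {x y : EuclideanSpace ℝ (Fin m)} (hx : ‖x‖ < 1) (hy : 1 ≤ ‖y‖) :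
    ∃ z, ‖z‖ = 1 ∧ dist x z ≤ dist x y := by
  have hc : ContinuousOn (fun t : ℝ => ‖x + t • (y - x)‖) (Icc 0 1) := by fun_prop
  obtain ⟨t, ht, hz⟩ := intermediate_value_Icc zero_le_one hc (show (1 : ℝ) ∈ _ by
    simp only [zero_smul, add_zero, one_smul, add_sub_cancel]
    exact ⟨hx.le, hy⟩)
  refine ⟨_, hz, ?_⟩
  rw [dist_self_add_right, norm_smul, dist_comm x y, dist_eq_norm, Real.norm_of_nonneg ht.1]
  exact mul_le_of_le_one_left (norm_nonneg _) ht.2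

theorem isRegularDomain_ball : IsRegularDomain (Metric.ball (0 : EuclideanSpace ℝ (Fin m)) 1) where
  isOpen := Metric.isOpen_ball
  isBounded := Metric.isBounded_ball
  isConnected := (convex_ball 0 1).isConnected ⟨0, by simp⟩
  volume_frontier := (convex_ball 0 1).addHaar_frontier _

/-- Extending by zero a Hölder continuous map on the closed unit ball that vanishes on the
sphere. -/
theorem norm_indicator_ball_sub_le {g : EuclideanSpace ℝ (Fin m) → EuclideanSpace ℝ (Fin d)}
    {C : ℝ} (hC : 0 ≤ C) (h0 : ∀ x, ‖x‖ = 1 → g x = 0)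
    (hg : ∀ x, ‖x‖ ≤ 1 → ∀ y, ‖y‖ ≤ 1 → ‖g x - g y‖ ≤ C * dist x y ^ (α : ℝ))
    (x y : EuclideanSpace ℝ (Fin m)) :
    ‖(Metric.ball 0 1).indicator g x - (Metric.ball 0 1).indicator g y‖ ≤
      C * dist x y ^ (α : ℝ) := by
  have key : ∀ x y : EuclideanSpace ℝ (Fin m), ‖x‖ < 1 → 1 ≤ ‖y‖ →
      ‖g x‖ ≤ C * dist x y ^ (α : ℝ) := by
    intro x y hx hy
    obtain ⟨z, hz, hxz⟩ := exists_norm_eq_one_dist_le hx hy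
    have := hg x hx.le z hz.le
    rw [h0 z hz, sub_zero] at this
    exact this.trans (by gcongr)
  by_cases hx : x ∈ Metric.ball (0 : EuclideanSpace ℝ (Fin m)) 1 <;>
    by_cases hy : y ∈ Metric.ball (0 : EuclideanSpace ℝ (Fin m)) 1
  · rw [indicator_of_mem hx, indicator_of_mem hy]
    exact hg x (mem_ball_zero_iff.mp hx).le y (mem_ball_zero_iff.mp hy).le
  · rw [indicator_of_mem hx, indicator_of_notMem hy, sub_zero]
    exact key x y (mem_ball_zero_iff.mp hx) (not_lt.mp fun h => hy (mem_ball_zero_iff.mpr h))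
  · rw [indicator_of_notMem hx, indicator_of_mem hy, zero_sub, norm_neg, dist_comm]
    exact key y x (mem_ball_zero_iff.mp hy) (not_lt.mp fun h => hx (mem_ball_zero_iff.mpr h))
  · rw [indicator_of_notMem hx, indicator_of_notMem hy, sub_zero, norm_zero]
    positivity

end Holder

/-! ### The model correction on the unit ball -/

section Model

variable {d m : ℕ} {U K : Set (Matrix (Fin d) (Fin m) ℝ)} {p M c₀ ε : ℝ} {α : ℝ≥0}

/-- A neighbourhood has positive measure. This upgrades almost everywhere statements about locally
constant gradients to pointwise ones. -/
theorem exists_of_eventually_of_ae {x : EuclideanSpace ℝ (Fin m)}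
    {P Q : EuclideanSpace ℝ (Fin m) → Prop} (hP : ∀ᶠ y in 𝓝 x, P y) (hQ : ∀ᵐ y, Q y) :
    ∃ y, P y ∧ Q y := by
  by_contra! hcon
  exact (Measure.measure_pos_of_mem_nhds volume hP).ne'
    (measure_mono_null (fun y hy => hcon y hy) (ae_iff.mp hQ))

/-- The weak gradient of a piecewise affine map has a representative that is equal to the slope
on each piece. -/
theorem exists_slope_of_isPiecewiseAffineOn {Ω : Set (EuclideanSpace ℝ (Fin m))}
    {w : EuclideanSpace ℝ (Fin m) → EuclideanSpace ℝ (Fin d)}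
    {G : EuclideanSpace ℝ (Fin m) → Matrix (Fin d) (Fin m) ℝ}
    (hw : IsW11 Ω w G) (hpw : IsPiecewiseAffineOn Ω w) :
    ∃ (V : Set (EuclideanSpace ℝ (Fin m)))
      (J : EuclideanSpace ℝ (Fin m) → Matrix (Fin d) (Fin m) ℝ),
      IsOpen V ∧ V ⊆ Ω ∧ volume (Ω \ V) = 0 ∧ (∀ x ∈ V, AffineNear w J x) ∧
      ∀ᵐ x, x ∈ V → G x = J x := by
  classical
  obtain ⟨S, hSc, hSd, hS, hS0⟩ := hpw
  choose! Y b hYb using fun D (hD : D ∈ S) => (hS D hD).2.2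
  set J : EuclideanSpace ℝ (Fin m) → Matrix (Fin d) (Fin m) ℝ := fun x =>
    if hx : ∃ D ∈ S, x ∈ D then Y hx.choose else 0
  have hJ : ∀ D ∈ S, ∀ x ∈ D, J x = Y D := by
    intro D hD x hx
    have hex : ∃ D ∈ S, x ∈ D := ⟨D, hD, hx⟩
    have : hex.choose = D := by
      by_contra hne
      exact Set.disjoint_left.mp (hSd hex.choose_spec.1 hD hne) hex.choose_spec.2 hx
    simp only [J, dif_pos hex, this]
  refine ⟨⋃₀ S, J, isOpen_sUnion fun D hD => (hS D hD).1.isOpen,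
    sUnion_subset fun D hD => (hS D hD).2.1, hS0, ?_, ?_⟩
  · rintro x ⟨D, hD, hx⟩
    exact affineNear_of_eqOn (hS D hD).1.isOpen (hYb D hD) (hJ D hD) hx
  · have : ∀ᵐ x, ∀ D ∈ S, x ∈ D → G x = Y D :=
      (ae_ball_iff hSc).mpr fun D hD =>
        hw.ae_eq_of_eqOn_affMap (hS D hD).1.isOpen (hS D hD).2.1 (hYb D hD)
    filter_upwards [this] with x hx
    rintro ⟨D, hD, hxD⟩
    rw [hx D hD hxD, hJ D hD x hxD]

/-- The correction is the difference of `w` and its affine boundary datum, extended by zero. The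
extension is Hölder continuous because the difference vanishes on the sphere. The constant `C` may
depend on `X` in any way, since rescaling will absorb it. -/
theorem IsReducingMap.exists_isCorrection {X : Matrix (Fin d) (Fin m) ℝ}
    {w : EuclideanSpace ℝ (Fin m) → EuclideanSpace ℝ (Fin d)}
    {G : EuclideanSpace ℝ (Fin m) → Matrix (Fin d) (Fin m) ℝ}
    (h : IsReducingMap U K p M (Metric.ball 0 1) X 0 ε α p w G) (hp : 1 < p) (hM : 0 ≤ M)
    (hα₀ : 0 < α) (hα₁ : α < 1)
    (hlow : ∀ t : ℝ, 1 < t →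
      ENNReal.ofReal (c₀ ^ p * t ^ (-p)) * volume (Metric.ball (0 : EuclideanSpace ℝ (Fin m)) 1) ≤
        volume {x ∈ Metric.ball (0 : EuclideanSpace ℝ (Fin m)) 1 | t < matNorm (G x)}) :
    ∃ C f V H, IsCorrection U K p M c₀ ε α C (Metric.ball 0 1) V (fun _ => X) f H := by
  classical
  set B := Metric.ball (0 : EuclideanSpace ℝ (Fin m)) 1
  have hBm : MeasurableSet B := Metric.isOpen_ball.measurableSet
  obtain ⟨V, J, hVo, hVB, hV0, hVJ, hGJ⟩ :=
    exists_slope_of_isPiecewiseAffineOn h.data.isW11 h.data.isPiecewiseAffineOn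
  set g : EuclideanSpace ℝ (Fin m) → EuclideanSpace ℝ (Fin d) := fun x => w x - affMap X 0 x
  set f := B.indicator g
  set H := B.indicator fun x => J x - X
  have hHV : ∀ x ∈ V, X + H x = J x := fun x hx => by
    simp only [H, indicator_of_mem (hVB hx), add_sub_cancel]
  have haeV : ∀ᵐ x, x ∈ B → x ∈ V := by
    filter_upwards [measure_eq_zero_iff_ae_notMem.mp hV0] with x hx hxB
    by_contra hxV
    exact hx ⟨hxB, hxV⟩
  have hGH : ∀ᵐ x, x ∈ B → G x = X + H x := by
    filter_upwards [haeV, hGJ] with x hxV hx hxB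
    rw [hx (hxV hxB), hHV x (hxV hxB)]
  have hcl : closure B = Metric.closedBall 0 1 := closure_ball 0 one_ne_zero
  have hfr : frontier B = Metric.sphere 0 1 := frontier_ball 0 one_ne_zero
  obtain ⟨C₁, hC₁0, hC₁, hC₁'⟩ := exists_holder_of_holderENorm_lt_top h.data.holder
  obtain ⟨C₂, hC₂0, hC₂, hC₂'⟩ := exists_holder_affMap (α := α) hα₁.le X 0
    (A := closure B) (by rw [hcl]; exact Metric.isBounded_closedBall)
  rw [hcl] at hC₁ hC₁' hC₂ hC₂'
  have hgb : ∀ x, ‖x‖ ≤ 1 → ‖g x‖ ≤ C₁ + C₂ := fun x hx =>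
    (norm_sub_le _ _).trans (add_le_add (hC₁ x (mem_closedBall_zero_iff.mpr hx))
      (hC₂ x (mem_closedBall_zero_iff.mpr hx)))
  have hgh : ∀ x, ‖x‖ ≤ 1 → ∀ y, ‖y‖ ≤ 1 → ‖g x - g y‖ ≤ (C₁ + C₂) * dist x y ^ (α : ℝ) := by
    intro x hx y hy
    have e : g x - g y = (w x - w y) - (affMap X 0 x - affMap X 0 y) := by
      simp only [g]; abel
    rw [e, add_mul]
    exact (norm_sub_le _ _).trans (add_le_add
      (hC₁' x (mem_closedBall_zero_iff.mpr hx) y (mem_closedBall_zero_iff.mpr hy))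
      (hC₂' x (mem_closedBall_zero_iff.mpr hx) y (mem_closedBall_zero_iff.mpr hy)))
  have hg0 : ∀ x, ‖x‖ = 1 → g x = 0 := fun x hx => by
    simp only [g]
    rw [h.data.boundary x (by rw [hfr, mem_sphere_zero_iff_norm]; exact hx), sub_self]
  have hfh := norm_indicator_ball_sub_le (add_nonneg hC₁0 hC₂0) hg0 hgh
  have hfcont : Continuous f := by
    have : HolderWith (C₁ + C₂).toNNReal α f := by
      intro x y
      have := ENNReal.ofReal_le_ofReal (hfh x y)
      rw [← dist_eq_norm, ← edist_dist, ENNReal.ofReal_mul' (by positivity),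
        ← ENNReal.ofReal_rpow_of_nonneg dist_nonneg α.coe_nonneg, ← edist_dist] at this
      exact this
    exact this.continuous hα₀
  have hH0 : ∀ x ∉ B, H x = 0 := fun x hx => indicator_of_notMem hx _
  have hf0 : ∀ x ∉ B, f x = 0 := fun x hx => indicator_of_notMem hx _
  have hHi : ∀ i j, Integrable fun x => H x i j := by
    intro i j
    have h1 : IntegrableOn (fun x => G x i j - X i j) B :=
      (h.data.isW11.integrableOn_grad i j).sub
        (integrableOn_const measure_ball_lt_top.ne)
    rw [← integrable_indicator_iff hBm] at h1
    refine h1.congr ?_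
    filter_upwards [hGH] with x hx
    by_cases hxB : x ∈ B
    · rw [indicator_of_mem hxB, hx hxB]
      simp
    · rw [indicator_of_notMem hxB, hH0 x hxB]
      rfl
  have hweak : HasWeakGrad f H := by
    refine hasWeakGrad_of_ball hfcont hf0 hH0 hHi ?_
    intro φ hφ hφc hφB i j
    have e1 := h.data.isW11.integral_eq φ hφ hφc hφB i j
    have e2 := integral_affMap_mul_fderiv X 0 hφ hφc i j
    rw [← setIntegral_mul_of_tsupport_subset hφB (fun _ => X i j),
      ← setIntegral_mul_fderiv_of_tsupport_subset hφB (fun x => affMap X 0 x i)] at e2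
    rw [← setIntegral_mul_of_tsupport_subset hφB (fun x => H x i j),
      ← setIntegral_mul_fderiv_of_tsupport_subset hφB (fun x => f x i)]
    obtain ⟨C₃, hC₃⟩ := hφc.exists_bound_of_continuous hφ.continuous
    obtain ⟨C₄, hC₄⟩ := (hφc.fderiv_apply ℝ (EuclideanSpace.single j 1)).exists_bound_of_continuous
      (contDiff_fderiv_apply hφ _)
    have i1 : IntegrableOn (fun x => w x i * fderiv ℝ φ x (EuclideanSpace.single j 1)) B := by
      refine Integrable.mul_bdd ?_ (contDiff_fderiv_apply hφ _).aestronglyMeasurable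
        (Eventually.of_forall hC₄)
      exact (EuclideanSpace.proj (𝕜 := ℝ) i).integrable_comp h.data.isW11.integrableOn
    have i2 : IntegrableOn (fun x => affMap X 0 x i * fderiv ℝ φ x (EuclideanSpace.single j 1)) B := by
      refine Integrable.integrableOn (Continuous.integrable_of_hasCompactSupport ?_
        (hφc.fderiv_apply ℝ _).mul_left)
      exact ((EuclideanSpace.proj (𝕜 := ℝ) i).continuous.comp (continuous_affMap X 0)).mul
        (contDiff_fderiv_apply hφ _)
    have i3 : IntegrableOn (fun x => G x i j * φ x) B :=
      (h.data.isW11.integrableOn_grad i j).mul_bdd hφ.continuous.aestronglyMeasurable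
        (Eventually.of_forall hC₃)
    have i4 : IntegrableOn (fun x => X i j * φ x) B :=
      ((hφ.continuous.integrable_of_hasCompactSupport hφc).const_mul _).integrableOn
    have e3 : ∫ x in B, f x i * fderiv ℝ φ x (EuclideanSpace.single j 1) =
        ∫ x in B, (w x i * fderiv ℝ φ x (EuclideanSpace.single j 1) -
          affMap X 0 x i * fderiv ℝ φ x (EuclideanSpace.single j 1)) := by
      refine setIntegral_congr_fun hBm fun x hx => ?_
      simp only [f, indicator_of_mem hx, g, PiLp.sub_apply]
      ring
    have e4 : ∫ x in B, H x i j * φ x = ∫ x in B, (G x i j * φ x - X i j * φ x) := by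
      refine setIntegral_congr_ae hBm ?_
      filter_upwards [hGH] with x hx hxB
      rw [hx hxB, Matrix.add_apply]
      ring
    rw [e3, e4, integral_sub i1 i2, integral_sub i3 i4, e1, e2]
    ring
  -- The prescribed gradient and the slope representative agree almost everywhere, so every estimate
  -- transfers to the open set `V`.
  have hsets : ∀ P : Matrix (Fin d) (Fin m) ℝ → Prop,
      ({x | x ∈ V ∧ P (X + H x)} : Set _) =ᵐ[volume] {x | x ∈ B ∧ P (G x)} := by
    intro P
    filter_upwards [haeV, hGH] with x hxV hx
    refine propext ⟨fun hx' => ⟨hVB hx'.1, ?_⟩, fun hx' => ⟨hxV hx'.1, ?_⟩⟩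
    · rw [hx (hVB hx'.1)]; exact hx'.2
    · rw [← hx hx'.1]; exact hx'.2
  have hloc : ∀ x ∈ V, AffineNear f H x := by
    intro x hx
    have h1 := (hVJ x hx).add (affineNear_affMap (-X) 0)
    refine h1.congr ?_ ?_
    · filter_upwards [hVo.mem_nhds hx] with y hy
      simp only [f, indicator_of_mem (hVB hy), g, affMap, map_neg, LinearMap.neg_apply]
      abel
    · filter_upwards [hVo.mem_nhds hx] with y hy
      simp only [H, indicator_of_mem (hVB hy), sub_eq_add_neg]
  have hconst : ∀ x ∈ V, ∀ᶠ y in 𝓝 x, X + H y = X + H x := fun x hx => by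
    filter_upwards [hloc x hx] with y hy
    rw [hy.2]
  refine ⟨C₁ + C₂, f, V, H, hVo, hVB, hV0, hf0, hH0, hweak, ?_, hfh, hloc, ?_, ?_, ?_, ?_⟩
  · intro x
    by_cases hx : x ∈ B
    · simp only [f, indicator_of_mem hx]
      exact hgb x (mem_ball_zero_iff.mp hx).le
    · rw [hf0 x hx, norm_zero]
      exact add_nonneg hC₁0 hC₂0
  · intro x hx hxK
    -- A nearby point with the same slope at which the almost everywhere inclusion does hold.
    obtain ⟨y, ⟨hyV, hy⟩, hy2, hy3⟩ := exists_of_eventually_of_ae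
      ((hVo.eventually_mem hx).and (hconst x hx))
      (hGH.and ((ae_restrict_iff' hBm).mp h.error_mem))
    have e := hy2 (hVB hyV)
    rw [hy] at e
    have := hy3 (hVB hyV)
    rw [e] at this
    exact this hxK
  · have ho := isOpen_sep_of_eventually_eq hVo hconst fun Y => Y ∉ K
    calc ∫⁻ x in {x ∈ V | X + H x ∉ K}, gradWeight p (X + H x)
        = ∫⁻ x in {x ∈ V | X + H x ∉ K}, gradWeight p (G x) := by
          refine setLIntegral_congr_fun_ae ho.measurableSet ?_
          filter_upwards [hGH] with x hx hxV
          rw [hx (hVB hxV.1)]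
      _ = ∫⁻ x in {x ∈ B | G x ∉ K}, gradWeight p (G x) :=
          setLIntegral_congr (hsets fun Y => Y ∉ K)
      _ ≤ _ := h.error_small.le
  · intro t ht
    rw [measure_congr (hsets fun Y => t < matNorm Y)]
    refine (h.upper t ht).trans ?_
    have hX := matNorm_nonneg X
    have hMp : 0 ≤ M ^ p := Real.rpow_nonneg hM p
    have htp : 0 ≤ t ^ (-p) := Real.rpow_nonneg ht.le _
    rw [setLIntegral_const, ← mul_assoc, gradWeight, ← ENNReal.ofReal_mul (by positivity)]
    refine mul_le_mul_left (ENNReal.ofReal_le_ofReal ?_) _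
    have : 1 + matNorm X ^ p ≤ (1 + matNorm X) ^ p := by
      have := Real.add_rpow_le_rpow_add zero_le_one hX hp.le
      rwa [Real.one_rpow] at this
    calc M ^ p * (1 + matNorm X ^ p) * t ^ (-p) ≤ M ^ p * (1 + matNorm X) ^ p * t ^ (-p) := by
          gcongr
      _ = _ := by ring
  · intro t ht
    rw [measure_congr (hsets fun Y => t < matNorm Y)]
    exact hlow t ht

end Model

/-! ### Gluing corrections on small disjoint balls -/

namespace IsCorrection

variable {d m : ℕ} {U K : Set (Matrix (Fin d) (Fin m) ℝ)} {p M c₀ ε : ℝ} {α : ℝ≥0} {η : ℝ}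
  {G : EuclideanSpace ℝ (Fin m) → Matrix (Fin d) (Fin m) ℝ}

/-- Corrections on countably many disjoint sets that cover `B` up to a null set can be glued. -/
theorem glue {ι : Type*} [Countable ι] {B : Set (EuclideanSpace ℝ (Fin m))}
    {D V : ι → Set (EuclideanSpace ℝ (Fin m))}
    {f : ι → EuclideanSpace ℝ (Fin m) → EuclideanSpace ℝ (Fin d)}
    {H : ι → EuclideanSpace ℝ (Fin m) → Matrix (Fin d) (Fin m) ℝ}
    (hp : 1 < p) (hM : 0 ≤ M) (hη : 0 ≤ η)
    (hG : ∀ x ∈ B, ∀ᶠ y in 𝓝 x, G y = G x) (hBvol : volume B < ⊤)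
    (hBG : ∫⁻ x in B, gradWeight p (G x) < ⊤)
    (hDo : ∀ k, IsOpen (D k)) (hDB : ∀ k, D k ⊆ B) (hDd : Pairwise (Function.onFun Disjoint D))
    (hD0 : volume (B \ ⋃ k, D k) = 0)
    (h : ∀ k, IsCorrection U K p M c₀ ε α η (D k) (V k) G (f k) (H k)) :
    IsCorrection U K p M c₀ ε α (2 * η) B (⋃ k, V k) G (fun x => ∑' k, f k x)
      (fun x => ∑' k, H k x) := by
  have hne : ∀ {k l x}, x ∈ D k → l ≠ k → x ∉ D l := fun hx hlk hxl =>
    Set.disjoint_left.mp (hDd hlk) hxl hx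
  have hfs : ∀ {k x}, x ∈ D k → HasSum (fun k => f k x) (f k x) := fun {k x} hx =>
    hasSum_single k fun l hl => (h l).map_eq_zero x (hne hx hl)
  have hHs : ∀ {k x}, x ∈ D k → HasSum (fun k => H k x) (H k x) := fun {k x} hx =>
    hasSum_single k fun l hl => (h l).grad_eq_zero x (hne hx hl)
  have hf0 : ∀ {x}, (∀ k, x ∉ D k) → ∀ k, f k x = 0 := fun hx k => (h k).map_eq_zero _ (hx k)
  have hH0 : ∀ {x}, (∀ k, x ∉ D k) → ∀ k, H k x = 0 := fun hx k => (h k).grad_eq_zero _ (hx k)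
  have hVm : ∀ k, MeasurableSet (V k) := fun k => (h k).isOpen.measurableSet
  have hVd : Pairwise (Function.onFun Disjoint V) := fun k l hkl =>
    (hDd hkl).mono (h k).subset (h l).subset
  have hDm : ∀ k, MeasurableSet (D k) := fun k => (hDo k).measurableSet
  have hGD : ∀ k, ∀ x ∈ D k, ∀ᶠ y in 𝓝 x, G y = G x := fun k x hx => hG x (hDB k hx)
  have hsumvol : ∑' k, volume (D k) = volume (⋃ k, D k) := (measure_iUnion hDd hDm).symm
  have hUB : ⋃ k, D k ⊆ B := iUnion_subset hDB
  have hsumI : ∑' k, ∫⁻ x in D k, gradWeight p (G x) ≤ ∫⁻ x in B, gradWeight p (G x) := by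
    rw [← lintegral_iUnion hDm hDd]
    exact lintegral_mono_set hUB
  have hHV : ∀ {k x}, x ∈ V k → ∑' l, H l x = H k x := fun hx => (hHs ((h _).subset hx)).tsum_eq
  have hsep : ∀ P : Matrix (Fin d) (Fin m) ℝ → Prop, {x | x ∈ ⋃ k, V k ∧ P (G x + ∑' k, H k x)} =
      ⋃ k, {x | x ∈ V k ∧ P (G x + H k x)} := by
    intro P
    ext x
    simp only [mem_iUnion, mem_ofPred_eq]
    constructor
    · rintro ⟨⟨k, hk⟩, hx⟩
      rw [hHV hk] at hx
      exact ⟨k, hk, hx⟩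
    · rintro ⟨k, hk, hx⟩
      rw [← hHV hk] at hx
      exact ⟨⟨k, hk⟩, hx⟩
  have hopen : ∀ k, ∀ P : Matrix (Fin d) (Fin m) ℝ → Prop,
      MeasurableSet {x | x ∈ V k ∧ P (G x + H k x)} := fun k P =>
    (isOpen_sep_of_eventually_eq (h k).isOpen
      ((h k).eventually_add_eq (hGD k)) P).measurableSet
  refine ⟨isOpen_iUnion fun k => (h k).isOpen, iUnion_subset fun k => (h k).subset.trans (hDB k),
    ?_, ?_, ?_, ?_, ?_, ?_, ?_, ?_, ?_, ?_, ?_⟩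
  · refine measure_mono_null (t := (B \ ⋃ k, D k) ∪ ⋃ k, D k \ V k) ?_
      (measure_union_null hD0 (measure_iUnion_null fun k => (h k).volume_sdiff))
    rintro x ⟨hxB, hxV⟩
    by_cases hx : x ∈ ⋃ k, D k
    · obtain ⟨k, hk⟩ := mem_iUnion.mp hx
      exact Or.inr (mem_iUnion.mpr ⟨k, hk, fun hxk => hxV (mem_iUnion.mpr ⟨k, hxk⟩)⟩)
    · exact Or.inl ⟨hxB, hx⟩
  · intro x hx
    simp [hf0 fun k hk => hx (hDB k hk)]
  · intro x hx
    simp [hH0 fun k hk => hx (hDB k hk)]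
  · refine HasWeakGrad.of_hasSum (fun k => (h k).hasWeakGrad) ?_ ?_ ?_ ?_
    · have hle : ∀ k, ∫⁻ x, ‖f k x‖ₑ ≤ ENNReal.ofReal η * volume (D k) := by
        intro k
        rw [← setLIntegral_const, ← lintegral_indicator (hDm k)]
        refine lintegral_mono fun x => ?_
        by_cases hx : x ∈ D k
        · rw [indicator_of_mem hx, ← ofReal_norm]
          exact ENNReal.ofReal_le_ofReal ((h k).bound x)
        · simp [(h k).map_eq_zero x hx]
      refine ne_top_of_le_ne_top ?_ (ENNReal.tsum_le_tsum hle)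
      rw [ENNReal.tsum_mul_left, hsumvol]
      exact ENNReal.mul_ne_top ENNReal.ofReal_ne_top
        (ne_top_of_le_ne_top hBvol.ne (measure_mono hUB))
    · intro i j
      refine ne_top_of_le_ne_top ?_ (ENNReal.tsum_le_tsum fun k =>
        (h k).lintegral_enorm_grad_le hp hM (hGD k) i j)
      rw [ENNReal.tsum_mul_left]
      exact ENNReal.mul_ne_top ENNReal.ofReal_ne_top (ne_top_of_le_ne_top hBG.ne hsumI)
    · refine Eventually.of_forall fun x => Summable.hasSum ?_
      by_cases hx : ∃ k, x ∈ D k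
      · exact (hfs hx.choose_spec).summable
      · rw [not_exists] at hx
        simp only [hf0 hx]
        exact summable_zero
    · refine Eventually.of_forall fun x => Summable.hasSum ?_
      by_cases hx : ∃ k, x ∈ D k
      · exact (hHs hx.choose_spec).summable
      · rw [not_exists] at hx
        simp only [hH0 hx]
        exact summable_zero
  · intro x
    by_cases hx : ∃ k, x ∈ D k
    · obtain ⟨k, hk⟩ := hx
      rw [(hfs hk).tsum_eq]
      linarith [(h k).bound x]
    · rw [not_exists] at hx
      simp [hf0 hx, hη]
  -- For points in different pieces each summand vanishes at the other point, so it satisfies the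
  -- Hölder bound of its own piece; adding the two bounds produces the factor `2`.
  · have hd : ∀ x y : EuclideanSpace ℝ (Fin m), 0 ≤ η * dist x y ^ (α : ℝ) := fun x y => by
      positivity
    have hout : ∀ k x y, y ∉ D k → ‖f k x‖ ≤ η * dist x y ^ (α : ℝ) := by
      intro k x y hy
      have := (h k).holder x y
      rwa [(h k).map_eq_zero y hy, sub_zero] at this
    intro x y
    rw [mul_assoc, two_mul]
    by_cases hx : ∃ k, x ∈ D k <;> by_cases hy : ∃ k, y ∈ D k
    · obtain ⟨k, hk⟩ := hx
      obtain ⟨l, hl⟩ := hy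
      rw [(hfs hk).tsum_eq, (hfs hl).tsum_eq]
      by_cases hkl : k = l
      · subst hkl
        linarith [(h k).holder x y, hd x y]
      · have h1 := hout k x y (hne hl hkl)
        have h2 := hout l y x (hne hk fun e => hkl e.symm)
        rw [dist_comm] at h2
        exact (norm_sub_le _ _).trans (add_le_add h1 h2)
    · obtain ⟨k, hk⟩ := hx
      rw [not_exists] at hy
      simp only [hf0 hy, tsum_zero, (hfs hk).tsum_eq, sub_zero]
      linarith [hout k x y (hy k), hd x y]
    · obtain ⟨l, hl⟩ := hy
      rw [not_exists] at hx
      simp only [hf0 hx, tsum_zero, (hfs hl).tsum_eq, zero_sub, norm_neg]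
      have := hout l y x (hx l)
      rw [dist_comm] at this
      linarith [hd x y]
    · rw [not_exists] at hx hy
      simp only [hf0 hx, hf0 hy, tsum_zero, sub_zero, norm_zero]
      linarith [hd x y]
  · intro x hx
    obtain ⟨k, hk⟩ := mem_iUnion.mp hx
    refine ((h k).affineNear x hk).congr ?_ ?_
    · filter_upwards [(hDo k).mem_nhds ((h k).subset hk)] with y hy using (hfs hy).tsum_eq
    · filter_upwards [(hDo k).mem_nhds ((h k).subset hk)] with y hy using (hHs hy).tsum_eq
  · intro x hx
    obtain ⟨k, hk⟩ := mem_iUnion.mp hx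
    rw [hHV hk]
    exact (h k).mem x hk
  · rw [hsep fun X => X ∉ K]
    calc ∫⁻ x in ⋃ k, {x | x ∈ V k ∧ G x + H k x ∉ K}, gradWeight p (G x + ∑' k, H k x)
        ≤ ∑' k, ∫⁻ x in {x | x ∈ V k ∧ G x + H k x ∉ K}, gradWeight p (G x + ∑' k, H k x) :=
          lintegral_iUnion_le _ _
      _ = ∑' k, ∫⁻ x in {x | x ∈ V k ∧ G x + H k x ∉ K}, gradWeight p (G x + H k x) := by
          congr 1
          funext k
          refine setLIntegral_congr_fun (hopen k fun X => X ∉ K) fun x hx => ?_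
          simp only [hHV hx.1]
      _ ≤ ∑' k, ENNReal.ofReal ε * volume (D k) := ENNReal.tsum_le_tsum fun k => (h k).error
      _ ≤ ENNReal.ofReal ε * volume B := by
          rw [ENNReal.tsum_mul_left, hsumvol]
          gcongr
  · intro t ht
    rw [hsep fun X => t < matNorm X]
    calc _ ≤ ∑' k, volume {x | x ∈ V k ∧ t < matNorm (G x + H k x)} := measure_iUnion_le _
      _ ≤ ∑' k, ENNReal.ofReal (M ^ p * t ^ (-p)) * ∫⁻ x in D k, gradWeight p (G x) :=
          ENNReal.tsum_le_tsum fun k => (h k).upper t ht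
      _ ≤ _ := by
          rw [ENNReal.tsum_mul_left]
          gcongr
  · intro t ht
    have hB : volume B ≤ volume (⋃ k, D k) := by
      refine (measure_mono_ae ?_)
      filter_upwards [measure_eq_zero_iff_ae_notMem.mp hD0] with x hx hxB
      by_contra hxD
      exact hx ⟨hxB, hxD⟩
    rw [hsep fun X => t < matNorm X, measure_iUnion
      (fun k l hkl => (hVd hkl).mono (fun x hx => hx.1) fun x hx => hx.1)
      (fun k => hopen k fun X => t < matNorm X)]
    calc _ ≤ ENNReal.ofReal (c₀ ^ p * t ^ (-p)) * ∑' k, volume (D k) := by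
          rw [hsumvol]
          gcongr
      _ = ∑' k, ENNReal.ofReal (c₀ ^ p * t ^ (-p)) * volume (D k) := ENNReal.tsum_mul_left.symm
      _ ≤ _ := ENNReal.tsum_le_tsum fun k => (h k).lower t ht

/-- If there are corrections of all constant gradients `X ∈ U` on the unit ball, then there are
arbitrarily small corrections of all locally constant gradients with values in `U`. -/
theorem exists_of_ball (hp : 1 < p) (hM : 0 ≤ M) (hα₁ : α < 1)
    (hmodel : ∀ X ∈ U, ∃ C f V H, IsCorrection U K p M c₀ ε α C (Metric.ball 0 1) V
      (fun _ => X) f H)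
    {B : Set (EuclideanSpace ℝ (Fin m))} (hB : IsOpen B) (hBvol : volume B < ⊤)
    (hG : ∀ x ∈ B, ∀ᶠ y in 𝓝 x, G y = G x) (hGU : ∀ x ∈ B, G x ∈ U)
    (hBG : ∫⁻ x in B, gradWeight p (G x) < ⊤) (hη : 0 < η) :
    ∃ V f H, IsCorrection U K p M c₀ ε α η B V G f H := by
  choose! C f V H hcor using hmodel
  have hC : ∀ X ∈ U, 0 ≤ C X := fun X hX => (norm_nonneg _).trans ((hcor X hX).bound 0)
  have hα' : (0 : ℝ) < 1 - α := sub_pos.mpr (by exact_mod_cast hα₁)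
  -- The model constant `C (G x)` has no uniform bound over `U`, so the admissible radius depends on
  -- the point. Gluing doubles the Hölder constant, hence the target `η / 2`.
  have hR : ∀ x ∈ B, ∃ R : ℝ, 0 < R ∧ R ≤ 1 ∧ (∀ y ∈ Metric.ball x R, y ∈ B ∧ G y = G x) ∧
      C (G x) * R ^ (1 - α : ℝ) ≤ η / 2 := by
    intro x hx
    obtain ⟨R, hR0, hR⟩ := Metric.eventually_nhds_iff_ball.mp ((hB.eventually_mem hx).and (hG x hx))
    have hlim : Tendsto (fun r : ℝ => C (G x) * r ^ (1 - α : ℝ)) (𝓝[>] 0) (𝓝 0) := by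
      have h1 : Tendsto (fun r : ℝ => C (G x) * r ^ (1 - α : ℝ)) (𝓝 0)
          (𝓝 (C (G x) * 0 ^ (1 - α : ℝ))) :=
        ((Real.continuous_rpow_const hα'.le).tendsto 0).const_mul _
      rw [Real.zero_rpow hα'.ne', mul_zero] at h1
      exact h1.mono_left nhdsWithin_le_nhds
    obtain ⟨r, ⟨hr1, hr2⟩, hr0⟩ := (((hlim.eventually_le_const (half_pos hη)).and
      ((gt_mem_nhds (lt_min hR0 one_pos)).filter_mono nhdsWithin_le_nhds)).and
      self_mem_nhdsWithin).exists
    exact ⟨r, hr0, (hr2.trans_le (min_le_right _ _)).le, fun y hy => hR y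
      (Metric.ball_subset_ball (hr2.trans_le (min_le_left _ _)).le hy), hr1⟩
  choose! R hR0 hR1 hRB hRC using hR
  -- Every positive radius is admissible, so the covering theorem gives disjoint closed balls with
  -- radii below `R` that exhaust `B` up to a null set.
  obtain ⟨t, r, htc, htB, htr, htcov, htd⟩ := Besicovitch.exists_disjoint_closedBall_covering_ae
    volume (fun _ => univ) B (fun x hx δ hδ => ⟨δ / 2, trivial, by constructor <;> linarith⟩) R hR0
  have : Countable t := htc.to_subtype
  have hr0 : ∀ k : t, 0 < r k := fun k => (htr k k.2).2.1
  have hrR : ∀ k : t, r k < R k := fun k => (htr k k.2).2.2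
  have hball : ∀ k : t, ∀ y ∈ Metric.ball (k : EuclideanSpace ℝ (Fin m)) (r k),
      y ∈ B ∧ G y = G k := fun k y hy =>
    hRB k (htB k.2) y (Metric.ball_subset_ball (hrR k).le hy)
  have hpiece : ∀ k : t, IsCorrection U K p M c₀ ε α (η / 2) (Metric.ball k (r k)) _ G _ _ :=
    fun k => ((hcor (G k) (hGU k (htB k.2))).rescale k (hr0 k)
      ((hrR k).le.trans (hR1 k (htB k.2))) (le_trans (mul_le_mul_of_nonneg_left
        (Real.rpow_le_rpow (hr0 k).le (hrR k).le hα'.le) (hC _ (hGU k (htB k.2))))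
        (hRC k (htB k.2)))).congr_grad Metric.isOpen_ball.measurableSet fun x hx => (hball k x hx).2
  have hglue := glue hp hM (half_pos hη).le hG hBvol hBG (fun k => Metric.isOpen_ball)
    (fun k y hy => (hball k y hy).1) ?_ ?_ hpiece
  · rw [mul_div_cancel₀ η two_ne_zero] at hglue
    exact ⟨_, _, _, hglue⟩
  · intro k l hkl
    exact (htd k.2 l.2 (Subtype.coe_injective.ne hkl)).mono Metric.ball_subset_closedBall
      Metric.ball_subset_closedBall
  -- Passing from closed to open balls loses only countably many spheres, which are null.
  · refine measure_mono_null (t := (B \ ⋃ x ∈ t, Metric.closedBall x (r x)) ∪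
      ⋃ k : t, Metric.sphere (k : EuclideanSpace ℝ (Fin m)) (r k)) ?_
      (measure_union_null htcov (measure_iUnion_null fun k =>
        Measure.addHaar_sphere_of_ne_zero _ _ (hr0 k).ne'))
    rintro x ⟨hxB, hx⟩
    by_cases hxc : x ∈ ⋃ x ∈ t, Metric.closedBall x (r x)
    · right
      simp only [mem_iUnion] at hxc hx ⊢
      obtain ⟨k, hk, hxk⟩ := hxc
      refine ⟨⟨k, hk⟩, ?_⟩
      rw [← Metric.closedBall_sdiff_ball]
      exact ⟨hxk, fun hxb => hx ⟨⟨k, hk⟩, hxb⟩⟩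
    · exact Or.inl ⟨hxB, hxc⟩

end IsCorrection

/-- A sequence of corrections `f n`, with gradients `H n`, of a map with constant gradient `X₀` on
`Ω`. The `n`-th one is supported in the set `B n` where the gradient `G n` obtained so far is not
in `K`. -/
structure IsCorrectionSequence {d m : ℕ} (U K : Set (Matrix (Fin d) (Fin m) ℝ)) (p M c₀ : ℝ)
    (ε η : ℕ → ℝ) (α : ℝ≥0) (Ω : Set (EuclideanSpace ℝ (Fin m))) (X₀ : Matrix (Fin d) (Fin m) ℝ)
    (B V : ℕ → Set (EuclideanSpace ℝ (Fin m)))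
    (G : ℕ → EuclideanSpace ℝ (Fin m) → Matrix (Fin d) (Fin m) ℝ)
    (f : ℕ → EuclideanSpace ℝ (Fin m) → EuclideanSpace ℝ (Fin d))
    (H : ℕ → EuclideanSpace ℝ (Fin m) → Matrix (Fin d) (Fin m) ℝ) : Prop where
  domain_zero : B 0 = Ω
  grad_zero : G 0 = fun _ => X₀
  domain_succ : ∀ n, B (n + 1) = {x ∈ V n | G n x + H n x ∉ K}
  grad_succ : ∀ n, G (n + 1) = fun x => G n x + H n x
  eventually_eq : ∀ n, ∀ x ∈ B n, ∀ᶠ y in 𝓝 x, G n y = G n x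
  isCorrection : ∀ n, IsCorrection U K p M c₀ (ε n) α (η n) (B n) (V n) (G n) (f n) (H n)

/-! ### Iterating the correction step -/

section Existence

variable {d m : ℕ} {U K : Set (Matrix (Fin d) (Fin m) ℝ)} {p M c₀ : ℝ} {α : ℝ≥0}
  {ε η : ℕ → ℝ} {Ω : Set (EuclideanSpace ℝ (Fin m))} {X₀ : Matrix (Fin d) (Fin m) ℝ}

theorem exists_isCorrectionSequence (hp : 1 < p) (hM : 0 ≤ M) (hα₁ : α < 1)
    (hmodel : ∀ n, ∀ X ∈ U, ∃ C f V H,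
      IsCorrection U K p M c₀ (ε n) α C (Metric.ball 0 1) V (fun _ => X) f H)
    (hη : ∀ n, 0 < η n) (hΩ : IsOpen Ω) (hΩvol : volume Ω < ⊤) (hX₀ : X₀ ∈ U) :
    ∃ B V G f H, IsCorrectionSequence U K p M c₀ ε η α Ω X₀ B V G f H := by
  -- A state is the current gradient with its bad set, carrying exactly the invariants under which a
  -- further correction exists. The error bound of one step restores the finiteness of the weighted
  -- integral for the next.
  let S := {s : (EuclideanSpace ℝ (Fin m) → Matrix (Fin d) (Fin m) ℝ) ×
    Set (EuclideanSpace ℝ (Fin m)) // IsOpen s.2 ∧ volume s.2 < ⊤ ∧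
      (∀ x ∈ s.2, ∀ᶠ y in 𝓝 x, s.1 y = s.1 x) ∧ (∀ x ∈ s.2, s.1 x ∈ U) ∧
      ∫⁻ x in s.2, gradWeight p (s.1 x) < ⊤}
  have hstep : ∀ (n : ℕ) (s : S), ∃ V f H,
      IsCorrection U K p M c₀ (ε n) α (η n) s.1.2 V s.1.1 f H := fun n s =>
    IsCorrection.exists_of_ball hp hM hα₁ (hmodel n) s.2.1 s.2.2.1 s.2.2.2.1 s.2.2.2.2.1
      s.2.2.2.2.2 (hη n)
  choose V f H hcor using hstep
  let next : ℕ → S → S := fun n s =>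
    ⟨(fun x => s.1.1 x + H n s x, {x ∈ V n s | s.1.1 x + H n s x ∉ K}), by
      have hloc := (hcor n s).eventually_add_eq s.2.2.2.1
      refine ⟨isOpen_sep_of_eventually_eq (hcor n s).isOpen hloc fun X => X ∉ K, ?_,
        fun x hx => hloc x hx.1, fun x hx => (hcor n s).mem x hx.1 hx.2, ?_⟩
      · exact (measure_mono fun x hx => (hcor n s).subset hx.1).trans_lt s.2.2.1
      · exact (hcor n s).error.trans_lt (ENNReal.mul_lt_top ENNReal.ofReal_lt_top s.2.2.1)⟩
  let s : ℕ → S := fun n => Nat.rec ⟨(fun _ => X₀, Ω), hΩ, hΩvol,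
    fun _ _ => Eventually.of_forall fun _ => rfl, fun _ _ => hX₀, by
      change ∫⁻ x in Ω, gradWeight p X₀ < ⊤
      rw [setLIntegral_const]
      exact ENNReal.mul_lt_top ENNReal.ofReal_lt_top hΩvol⟩ next n
  exact ⟨fun n => (s n).1.2, fun n => V n (s n), fun n => (s n).1.1, fun n => f n (s n),
    fun n => H n (s n), rfl, rfl, fun _ => rfl, fun _ => rfl, fun n => (s n).2.2.2.1,
    fun n => hcor n (s n)⟩

end Existence

/-! ### Convergence of the correction sequence -/

namespace IsCorrectionSequence

variable {d m : ℕ} {U K : Set (Matrix (Fin d) (Fin m) ℝ)} {p M c₀ : ℝ} {α : ℝ≥0}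
  {ε η : ℕ → ℝ} {Ω : Set (EuclideanSpace ℝ (Fin m))} {X₀ : Matrix (Fin d) (Fin m) ℝ}
  {B V : ℕ → Set (EuclideanSpace ℝ (Fin m))}
  {G : ℕ → EuclideanSpace ℝ (Fin m) → Matrix (Fin d) (Fin m) ℝ}
  {f : ℕ → EuclideanSpace ℝ (Fin m) → EuclideanSpace ℝ (Fin d)}
  {H : ℕ → EuclideanSpace ℝ (Fin m) → Matrix (Fin d) (Fin m) ℝ}

theorem domain_antitone (h : IsCorrectionSequence U K p M c₀ ε η α Ω X₀ B V G f H) :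
    Antitone B :=
  antitone_nat_of_succ_le fun n => by
    rw [h.domain_succ n]
    exact fun x hx => (h.isCorrection n).subset hx.1

theorem domain_subset (h : IsCorrectionSequence U K p M c₀ ε η α Ω X₀ B V G f H) (n : ℕ) :
    B n ⊆ Ω :=
  h.domain_zero ▸ h.domain_antitone (Nat.zero_le n)

theorem grad_eq_sum (h : IsCorrectionSequence U K p M c₀ ε η α Ω X₀ B V G f H) (n : ℕ)
    (x : EuclideanSpace ℝ (Fin m)) : G n x = X₀ + ∑ k ∈ Finset.range n, H k x := by
  induction n with
  | zero => simp [h.grad_zero]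
  | succ n ih => simp only [h.grad_succ, ih, Finset.sum_range_succ, add_assoc]

theorem setLIntegral_succ_le (h : IsCorrectionSequence U K p M c₀ ε η α Ω X₀ B V G f H) (n : ℕ) :
    ∫⁻ x in B (n + 1), gradWeight p (G (n + 1) x) ≤ ENNReal.ofReal (ε n) * volume Ω := by
  rw [h.domain_succ, h.grad_succ]
  refine (h.isCorrection n).error.trans ?_
  gcongr
  exact h.domain_subset n

/-- The first term is an integral of a constant; each later one is the error left by its
predecessor, at most `ε n * |Ω|`. This finite sum governs the null bad set, the `L^1` convergence of
the gradients and the final weak bound. -/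
theorem tsum_setLIntegral_lt_top (h : IsCorrectionSequence U K p M c₀ ε η α Ω X₀ B V G f H)
    (hε : Summable ε) (hΩvol : volume Ω < ⊤) :
    ∑' n, ∫⁻ x in B n, gradWeight p (G n x) < ⊤ := by
  rw [tsum_eq_zero_add' ENNReal.summable]
  refine ENNReal.add_lt_top.mpr ⟨?_, ?_⟩
  · rw [h.domain_zero, h.grad_zero, setLIntegral_const]
    exact ENNReal.mul_lt_top ENNReal.ofReal_lt_top hΩvol
  · refine (ENNReal.tsum_le_tsum h.setLIntegral_succ_le).trans_lt ?_
    rw [ENNReal.tsum_mul_right]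
    exact ENNReal.mul_lt_top hε.tsum_ofReal_lt_top hΩvol

/-- A point whose gradient has reached `K` leaves the bad sets for good. All later corrections
vanish there, so the series reduce to finite sums. -/
theorem notMem_domain (h : IsCorrectionSequence U K p M c₀ ε η α Ω X₀ B V G f H) {n k : ℕ}
    {x : EuclideanSpace ℝ (Fin m)} (hK : G n x + H n x ∈ K) (hk : n < k) : x ∉ B k := by
  intro hxk
  have := h.domain_antitone hk hxk
  rw [h.domain_succ n] at this
  exact this.2 hK

theorem tsum_eq_sum_of_mem (h : IsCorrectionSequence U K p M c₀ ε η α Ω X₀ B V G f H) {n : ℕ}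
    {x : EuclideanSpace ℝ (Fin m)} (hK : G n x + H n x ∈ K) :
    ∑' k, f k x = ∑ k ∈ Finset.range (n + 1), f k x :=
  tsum_eq_sum fun k hk => (h.isCorrection k).map_eq_zero x
    (h.notMem_domain hK (by simpa using hk))

theorem hasSum_grad_of_mem (h : IsCorrectionSequence U K p M c₀ ε η α Ω X₀ B V G f H) {n : ℕ}
    {x : EuclideanSpace ℝ (Fin m)} (hK : G n x + H n x ∈ K) :
    HasSum (fun k => H k x) (∑ k ∈ Finset.range (n + 1), H k x) :=
  hasSum_sum_of_ne_finset_zero fun k hk => (h.isCorrection k).grad_eq_zero x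
    (h.notMem_domain hK (by simpa using hk))

theorem add_tsum_grad_eq (h : IsCorrectionSequence U K p M c₀ ε η α Ω X₀ B V G f H) {n : ℕ}
    {x : EuclideanSpace ℝ (Fin m)} (hK : G n x + H n x ∈ K) :
    X₀ + ∑' k, H k x = G n x + H n x := by
  rw [(h.hasSum_grad_of_mem hK).tsum_eq, Finset.sum_range_succ, ← add_assoc, ← h.grad_eq_sum]

/-- The weight is at least `1`, so the volumes of the bad sets are bounded by the terms of a
convergent series and tend to zero. -/
theorem ae_exists_mem (h : IsCorrectionSequence U K p M c₀ ε η α Ω X₀ B V G f H) (hp : 1 < p)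
    (hε : Summable ε) (hΩvol : volume Ω < ⊤) :
    ∀ᵐ x, x ∈ Ω → ∃ n, (∀ k ≤ n, x ∈ V k) ∧ G n x + H n x ∈ K := by
  have hV : ∀ᵐ x, ∀ n, x ∈ B n → x ∈ V n := by
    refine ae_all_iff.mpr fun n => ?_
    filter_upwards [measure_eq_zero_iff_ae_notMem.mp (h.isCorrection n).volume_sdiff] with x hx hxB
    by_contra hxV
    exact hx ⟨hxB, hxV⟩
  have hnull : volume (⋂ n, B n) = 0 := by
    have hlim := ENNReal.tendsto_atTop_zero_of_tsum_ne_top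
      (h.tsum_setLIntegral_lt_top hε hΩvol).ne
    refine le_antisymm (ge_of_tendsto' hlim fun n => ?_) zero_le
    exact (measure_mono (iInter_subset B n)).trans
      (volume_le_setLIntegral_gradWeight hp.le (G n) (B n))
  filter_upwards [hV, measure_eq_zero_iff_ae_notMem.mp hnull] with x hxV hx hxΩ
  classical
  have hex : ∃ n, x ∉ B n := by simpa using hx
  -- The first bad set missing `x` is not `B 0 = Ω`, so its index is a successor `n + 1`, and step
  -- `n` is the one that brings the gradient into `K`.
  obtain ⟨n, hn⟩ : ∃ n, Nat.find hex = n + 1 := by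
    refine Nat.exists_eq_succ_of_ne_zero fun h0 => ?_
    have := Nat.find_spec hex
    rw [h0, h.domain_zero] at this
    exact this hxΩ
  have hmem : ∀ k ≤ n, x ∈ V k := fun k hk =>
    hxV k (not_not.mp (Nat.find_min hex (m := k) (by omega)))
  refine ⟨n, hmem, ?_⟩
  have := Nat.find_spec hex
  rw [hn, h.domain_succ n] at this
  by_contra hK
  exact this ⟨hmem n le_rfl, hK⟩

/-- The gradient after step `n` is locally constant, hence in `K` on a whole neighbourhood. There
the series equals one and the same finite sum of locally affine maps. -/
theorem affineNear_tsum (h : IsCorrectionSequence U K p M c₀ ε η α Ω X₀ B V G f H) {n : ℕ}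
    {x : EuclideanSpace ℝ (Fin m)} (hV : ∀ k ≤ n, x ∈ V k) (hK : G n x + H n x ∈ K) :
    AffineNear (fun x => ∑' k, f k x) (fun x => ∑' k, H k x) x := by
  have hev : ∀ᶠ y in 𝓝 x, G n y + H n y ∈ K := by
    filter_upwards [(h.isCorrection n).eventually_add_eq (h.eventually_eq n) x (hV n le_rfl)]
      with y hy
    rwa [hy]
  refine (AffineNear.sum (Finset.range (n + 1)) (f := f) (H := H) fun k hk =>
    (h.isCorrection k).affineNear x (hV k (by simpa [Nat.lt_succ_iff] using hk))).congr ?_ ?_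
  · filter_upwards [hev] with y hy using h.tsum_eq_sum_of_mem hy
  · filter_upwards [hev] with y hy using (h.hasSum_grad_of_mem hy).tsum_eq

theorem summable_map (h : IsCorrectionSequence U K p M c₀ ε η α Ω X₀ B V G f H)
    (hη : Summable η) (x : EuclideanSpace ℝ (Fin m)) : Summable fun k => f k x :=
  Summable.of_norm_bounded hη fun k => (h.isCorrection k).bound x

theorem norm_tsum_le (h : IsCorrectionSequence U K p M c₀ ε η α Ω X₀ B V G f H)
    (hη : Summable η) (x : EuclideanSpace ℝ (Fin m)) : ‖∑' k, f k x‖ ≤ ∑' k, η k :=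
  tsum_of_norm_bounded hη.hasSum fun k => (h.isCorrection k).bound x

theorem norm_tsum_sub_le (h : IsCorrectionSequence U K p M c₀ ε η α Ω X₀ B V G f H)
    (hη : Summable η) (x y : EuclideanSpace ℝ (Fin m)) :
    ‖∑' k, f k x - ∑' k, f k y‖ ≤ (∑' k, η k) * dist x y ^ (α : ℝ) := by
  rw [← (h.summable_map hη x).tsum_sub (h.summable_map hη y)]
  exact tsum_of_norm_bounded (hη.hasSum.mul_right _) fun k => (h.isCorrection k).holder x y

theorem tsum_eq_zero (h : IsCorrectionSequence U K p M c₀ ε η α Ω X₀ B V G f H)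
    {x : EuclideanSpace ℝ (Fin m)} (hx : x ∉ Ω) : ∑' k, f k x = 0 := by
  have : ∀ k, f k x = 0 := fun k =>
    (h.isCorrection k).map_eq_zero x fun hxB => hx (h.domain_subset k hxB)
  simp [this]

theorem hasWeakGrad_tsum (h : IsCorrectionSequence U K p M c₀ ε η α Ω X₀ B V G f H) (hp : 1 < p)
    (hM : 0 ≤ M) (hε : Summable ε) (hη : Summable η) (hΩ : IsOpen Ω) (hΩvol : volume Ω < ⊤) :
    HasWeakGrad (fun x => ∑' k, f k x) (fun x => ∑' k, H k x) := by
  refine HasWeakGrad.of_hasSum (fun k => (h.isCorrection k).hasWeakGrad) ?_ ?_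
    (Eventually.of_forall fun x => (h.summable_map hη x).hasSum) ?_
  · have hle : ∀ k, ∫⁻ x, ‖f k x‖ₑ ≤ ENNReal.ofReal (η k) * volume Ω := by
      intro k
      rw [← setLIntegral_const, ← lintegral_indicator hΩ.measurableSet]
      refine lintegral_mono fun x => ?_
      by_cases hx : x ∈ Ω
      · rw [indicator_of_mem hx, ← ofReal_norm]
        exact ENNReal.ofReal_le_ofReal ((h.isCorrection k).bound x)
      · simp [(h.isCorrection k).map_eq_zero x fun hxB => hx (h.domain_subset k hxB)]
    refine ne_top_of_le_ne_top ?_ (ENNReal.tsum_le_tsum hle)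
    rw [ENNReal.tsum_mul_right]
    exact ENNReal.mul_ne_top hη.tsum_ofReal_ne_top hΩvol.ne
  · intro i j
    refine ne_top_of_le_ne_top ?_ (ENNReal.tsum_le_tsum fun k =>
      (h.isCorrection k).lintegral_enorm_grad_le hp hM (h.eventually_eq k) i j)
    rw [ENNReal.tsum_mul_left]
    exact ENNReal.mul_ne_top ENNReal.ofReal_ne_top (h.tsum_setLIntegral_lt_top hε hΩvol).ne
  · filter_upwards [h.ae_exists_mem hp hε hΩvol] with x hx
    refine Summable.hasSum ?_
    by_cases hxΩ : x ∈ Ω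
    · obtain ⟨n, -, hn⟩ := hx hxΩ
      exact (h.hasSum_grad_of_mem hn).summable
    · have : ∀ k, H k x = 0 := fun k =>
        (h.isCorrection k).grad_eq_zero x fun hxB => hxΩ (h.domain_subset k hxB)
      simp only [this]
      exact summable_zero

/-- Almost every point keeps the gradient of the step at which it settles, so the superlevel set is
covered by those of the single steps. -/
theorem volume_lt_matNorm_le (h : IsCorrectionSequence U K p M c₀ ε η α Ω X₀ B V G f H)
    (hp : 1 < p) (hε : Summable ε) (hΩvol : volume Ω < ⊤) {t : ℝ} (ht : 0 < t) :
    volume {x ∈ Ω | t < matNorm (X₀ + ∑' k, H k x)} ≤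
      ENNReal.ofReal (M ^ p * t ^ (-p)) * ∑' n, ∫⁻ x in B n, gradWeight p (G n x) := by
  calc volume {x ∈ Ω | t < matNorm (X₀ + ∑' k, H k x)}
      ≤ volume (⋃ n, {x ∈ V n | t < matNorm (G n x + H n x)}) := by
        refine measure_mono_ae ?_
        filter_upwards [h.ae_exists_mem hp hε hΩvol] with x hx hxt
        obtain ⟨n, hV, hK⟩ := hx hxt.1
        refine mem_iUnion.mpr ⟨n, hV n le_rfl, ?_⟩
        rw [← h.add_tsum_grad_eq hK]
        exact hxt.2
    _ ≤ ∑' n, volume {x ∈ V n | t < matNorm (G n x + H n x)} := measure_iUnion_le _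
    _ ≤ ∑' n, ENNReal.ofReal (M ^ p * t ^ (-p)) * ∫⁻ x in B n, gradWeight p (G n x) :=
        ENNReal.tsum_le_tsum fun n => (h.isCorrection n).upper t ht
    _ = _ := ENNReal.tsum_mul_left

/-- Points in the superlevel set of the first step either have settled, and keep their gradient, or
lie in `A`. Chebyshev's inequality and the error of the first step show that `A` takes up at most
half of the lower bound. -/
theorem le_volume_lt_matNorm (h : IsCorrectionSequence U K p M c₀ ε η α Ω X₀ B V G f H)
    (hp : 1 < p) (hc₀ : 0 < c₀) (hε : ε 0 ≤ c₀ ^ p / 2) (hΩvol : volume Ω < ⊤)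
    {t : ℝ} (ht : 1 < t) :
    ENNReal.ofReal (c₀ ^ p / 2 * t ^ (-p)) * volume Ω ≤
      volume {x ∈ Ω | t < matNorm (X₀ + ∑' k, H k x)} := by
  have ht0 : 0 < t := zero_lt_one.trans ht
  have htp : 0 < t ^ (-p) := Real.rpow_pos_of_pos ht0 _
  have hcp : 0 < c₀ ^ p := Real.rpow_pos_of_pos hc₀ _
  set A := {x ∈ B 1 | t < matNorm (G 1 x)}
  have hAo : MeasurableSet A := by
    have hB : IsOpen (B 1) := by
      rw [h.domain_succ 0]
      exact isOpen_sep_of_eventually_eq (h.isCorrection 0).isOpen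
        ((h.isCorrection 0).eventually_add_eq (h.eventually_eq 0)) fun X => X ∉ K
    exact (isOpen_sep_of_eventually_eq hB (h.eventually_eq 1) fun X => t < matNorm X).measurableSet
  have hA : volume A ≤ ENNReal.ofReal (c₀ ^ p / 2 * t ^ (-p)) * volume Ω := by
    calc volume A = ∫⁻ _ in A, 1 := (setLIntegral_one A).symm
      _ ≤ ∫⁻ x in A, ENNReal.ofReal (t ^ (-p)) * gradWeight p (G 1 x) := by
          refine setLIntegral_mono' hAo fun x hx => ?_
          rw [gradWeight, ← ENNReal.ofReal_mul htp.le, ← ENNReal.ofReal_one]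
          refine ENNReal.ofReal_le_ofReal ?_
          have h1 : t ^ p ≤ (1 + matNorm (G 1 x)) ^ p :=
            Real.rpow_le_rpow ht0.le (by linarith [hx.2]) (by linarith)
          calc 1 = t ^ (-p) * t ^ p := by rw [← Real.rpow_add ht0]; simp
            _ ≤ _ := by gcongr
      _ = ENNReal.ofReal (t ^ (-p)) * ∫⁻ x in A, gradWeight p (G 1 x) :=
          lintegral_const_mul' _ _ ENNReal.ofReal_ne_top
      _ ≤ ENNReal.ofReal (t ^ (-p)) * (ENNReal.ofReal (ε 0) * volume Ω) := by
          gcongr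
          exact (lintegral_mono_set fun x hx => hx.1).trans (h.setLIntegral_succ_le 0)
      _ ≤ ENNReal.ofReal (t ^ (-p)) * (ENNReal.ofReal (c₀ ^ p / 2) * volume Ω) := by gcongr
      _ = _ := by rw [mul_comm (c₀ ^ p / 2), ENNReal.ofReal_mul htp.le, mul_assoc]
  have hlow := (h.isCorrection 0).lower t ht
  rw [h.domain_zero] at hlow
  have hsub : {x ∈ V 0 | t < matNorm (G 0 x + H 0 x)} ⊆
      {x ∈ Ω | t < matNorm (X₀ + ∑' k, H k x)} ∪ A := by
    rintro x ⟨hxV, hxt⟩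
    by_cases hK : G 0 x + H 0 x ∈ K
    · refine Or.inl ⟨h.domain_subset 0 ((h.isCorrection 0).subset hxV), ?_⟩
      rwa [h.add_tsum_grad_eq hK]
    · refine Or.inr ⟨?_, ?_⟩
      · rw [h.domain_succ 0]
        exact ⟨hxV, hK⟩
      · rw [h.grad_succ 0]
        exact hxt
  have hfin : ENNReal.ofReal (c₀ ^ p / 2 * t ^ (-p)) * volume Ω ≠ ⊤ :=
    ENNReal.mul_ne_top ENNReal.ofReal_ne_top hΩvol.ne
  -- The bound for `A` is added to both sides and then cancelled, which requires it to be finite.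
  refine (ENNReal.add_le_add_iff_right hfin).mp ?_
  calc ENNReal.ofReal (c₀ ^ p / 2 * t ^ (-p)) * volume Ω +
        ENNReal.ofReal (c₀ ^ p / 2 * t ^ (-p)) * volume Ω
      = ENNReal.ofReal (c₀ ^ p * t ^ (-p)) * volume Ω := by
        rw [← add_mul, ← ENNReal.ofReal_add (by positivity) (by positivity)]
        congr 2
        ring
    _ ≤ volume {x ∈ V 0 | t < matNorm (G 0 x + H 0 x)} := hlow
    _ ≤ _ := (measure_mono hsub).trans (measure_union_le _ _)
    _ ≤ _ := by gcongr

end IsCorrectionSequence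

/-! ### Assembling the exact solution -/

section Final

variable {d m : ℕ}

theorem HasWeakGrad.isW11_affMap_add {f : EuclideanSpace ℝ (Fin m) → EuclideanSpace ℝ (Fin d)}
    {H : EuclideanSpace ℝ (Fin m) → Matrix (Fin d) (Fin m) ℝ} (h : HasWeakGrad f H)
    {Ω : Set (EuclideanSpace ℝ (Fin m))} (hΩ : Bornology.IsBounded Ω)
    (X : Matrix (Fin d) (Fin m) ℝ) (b : EuclideanSpace ℝ (Fin d)) :
    IsW11 Ω (fun x => affMap X b x + f x) (fun x => X + H x) := by
  have hfin : volume Ω ≠ ⊤ := hΩ.measure_lt_top.ne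
  refine ⟨?_, ?_, ?_⟩
  · refine Integrable.add ?_ h.integrable.integrableOn
    exact ((continuous_affMap X b).continuousOn.integrableOn_compact hΩ.isCompact_closure).mono_set
      subset_closure
  · exact fun i j => (integrableOn_const hfin).add (h.integrable_grad i j).integrableOn
  · intro φ hφ hφc hφΩ i j
    have e1 := h.integral_eq φ hφ hφc i j
    have e2 := integral_affMap_mul_fderiv X b hφ hφc i j
    obtain ⟨C₁, hC₁⟩ := hφc.exists_bound_of_continuous hφ.continuous
    obtain ⟨C₂, hC₂⟩ := (hφc.fderiv_apply ℝ (EuclideanSpace.single j 1)).exists_bound_of_continuous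
      (contDiff_fderiv_apply hφ _)
    rw [setIntegral_mul_fderiv_of_tsupport_subset hφΩ fun x => (affMap X b x + f x) i]
    have e3 := setIntegral_mul_of_tsupport_subset hφΩ fun x => (X + H x) i j
    rw [e3]
    simp only [PiLp.add_apply, Matrix.add_apply, add_mul]
    rw [integral_add, integral_add, e1, e2]
    · ring
    · exact (hφ.continuous.integrable_of_hasCompactSupport hφc).const_mul _
    · exact (h.integrable_grad i j).mul_bdd hφ.continuous.aestronglyMeasurable
        (Eventually.of_forall hC₁)
    · exact (((EuclideanSpace.proj (𝕜 := ℝ) i).continuous.comp (continuous_affMap X b)).mul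
        (contDiff_fderiv_apply hφ _)).integrable_of_hasCompactSupport
        (hφc.fderiv_apply ℝ _).mul_left
    · exact ((EuclideanSpace.proj (𝕜 := ℝ) i).integrable_comp h.integrable).mul_bdd
        (contDiff_fderiv_apply hφ _).aestronglyMeasurable (Eventually.of_forall hC₂)

/-- The corrections on the unit ball provided by reducibility. The constant `c₀` in the lower
bound is positive if the reduction is exact. -/
theorem CanBeReduced.exists_isCorrection {U K : Set (Matrix (Fin d) (Fin m) ℝ)} {p : ℝ}
    (hp : 1 < p) (hred : CanBeReduced U K p) :
    ∃ M c₀ : ℝ, 0 ≤ M ∧ 0 ≤ c₀ ∧ (CanBeReducedExactly U K p → 0 < c₀) ∧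
      ∀ ε : ℝ, 0 < ε → ε < 1 → ∀ α : ℝ≥0, 0 < α → α < 1 → ∀ X ∈ U, ∃ C f V H,
        IsCorrection U K p M c₀ ε α C (Metric.ball 0 1) V (fun _ => X) f H := by
  -- In the exact case the constant `M` and the maps must come from exact reducibility, so that
  -- upper and lower bounds hold for the same map. Otherwise `c₀ = 0` makes the lower bound vacuous,
  -- as `0 ^ p = 0`.
  by_cases hex : CanBeReducedExactly U K p
  · obtain ⟨M, hM, c₀, hc₀, h⟩ := hex
    refine ⟨M, c₀, by linarith, hc₀.le, fun _ => hc₀, ?_⟩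
    intro ε hε hε1 α hα₀ hα₁ X hX
    obtain ⟨w, G, hw, hlow⟩ := h X hX 0 ε hε hε1 α hα₀ hα₁ p hp _ isRegularDomain_ball
    exact hw.exists_isCorrection hp (by linarith) hα₀ hα₁ hlow
  · obtain ⟨M, hM, h⟩ := hred
    refine ⟨M, 0, by linarith, le_rfl, fun h => absurd h hex, ?_⟩
    intro ε hε hε1 α hα₀ hα₁ X hX
    obtain ⟨w, G, hw⟩ := h X hX 0 ε hε hε1 α hα₀ hα₁ p hp _ isRegularDomain_ball
    refine hw.exists_isCorrection hp (by linarith) hα₀ hα₁ fun t ht => ?_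
    simp [Real.zero_rpow (by linarith : p ≠ 0)]

end Final

theorem theorem1p2 {d m : ℕ} (K U : Set (Matrix (Fin d) (Fin m) ℝ)) (hU : IsOpen U)
    (p : ℝ) (hp : 1 < p) (hred : CanBeReduced U K p)
    (Ω : Set (EuclideanSpace ℝ (Fin m))) (hΩ : IsRegularDomain Ω)
    (X₀ : Matrix (Fin d) (Fin m) ℝ) (hX₀ : X₀ ∈ U) (b : EuclideanSpace ℝ (Fin d))
    (δ : ℝ) (hδ : 0 < δ) (α : ℝ≥0) (hα₀ : 0 < α) (hα₁ : α < 1) :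
    ∃ (w : EuclideanSpace ℝ (Fin m) → EuclideanSpace ℝ (Fin d))
      (G : EuclideanSpace ℝ (Fin m) → Matrix (Fin d) (Fin m) ℝ),
      IsPiecewiseAffineWithData Ω α X₀ b w G ∧
      (∀ᵐ x ∂(volume.restrict Ω), G x ∈ K) ∧
      holderENorm α (closure Ω) (fun x => w x - affMap X₀ b x) < ENNReal.ofReal δ ∧
      (∃ C : ℝ, 0 < C ∧ ∀ t : ℝ, 0 < t →
        volume {x ∈ Ω | t < matNorm (G x)} ≤ ENNReal.ofReal (C * t ^ (-p))) ∧
      (CanBeReducedExactly U K p → ∃ c : ℝ, 0 < c ∧ ∀ t : ℝ, 1 < t →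
        ENNReal.ofReal (c * t ^ (-p)) ≤ volume {x ∈ Ω | t < matNorm (G x)}) := by
  obtain ⟨M, c₀, hM, hc₀, hexact, hmodel⟩ := hred.exists_isCorrection hp
  have hΩvol : volume Ω < ⊤ := hΩ.isBounded.measure_lt_top
  -- `e` will be `ε 0`: below `1` as reducibility requires, and at most `c₀ ^ p / 2` when a lower
  -- bound has to survive.
  obtain ⟨e, he0, he1, hec⟩ : ∃ e : ℝ, 0 < e ∧ e < 1 ∧ (0 < c₀ → e ≤ c₀ ^ p / 2) := by
    rcases hc₀.eq_or_lt with h0 | h0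
    · exact ⟨1 / 2, by norm_num, by norm_num, fun h => absurd h0 h.ne⟩
    · have := Real.rpow_pos_of_pos h0 p
      exact ⟨min (1 / 2) (c₀ ^ p / 2), lt_min (by norm_num) (by positivity),
        (min_le_left _ _).trans_lt (by norm_num), fun _ => min_le_right _ _⟩
  set ε : ℕ → ℝ := fun n => e * (1 / 2) ^ n with hεdef
  set η : ℕ → ℝ := fun n => δ / 8 * (1 / 2) ^ n
  have hε : Summable ε := summable_geometric_two.mul_left e
  have hη : Summable η := summable_geometric_two.mul_left (δ / 8)
  have hηsum : ∑' n, η n = δ / 4 := by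
    -- The Hölder norm adds a sup norm and a seminorm, each at most `δ / 4`; the total `δ / 2`
    -- leaves room for the strict inequality.
    rw [tsum_mul_left, tsum_geometric_two]
    ring
  obtain ⟨B, V, G, f, H, h⟩ := exists_isCorrectionSequence (K := K) (M := M) (c₀ := c₀) (ε := ε)
    (η := η) hp hM hα₁
    (fun n => hmodel (ε n) (by positivity) ((mul_le_of_le_one_right he0.le
      (pow_le_one₀ (by norm_num) (by norm_num))).trans_lt he1) α hα₀ hα₁)
    (fun n => by positivity) hΩ.isOpen hΩvol hX₀
  have hF1 : ∀ x, ‖∑' k, f k x‖ ≤ δ / 4 := fun x => hηsum ▸ h.norm_tsum_le hη x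
  have hF2 : ∀ x y, ‖∑' k, f k x - ∑' k, f k y‖ ≤ δ / 4 * dist x y ^ (α : ℝ) := fun x y =>
    hηsum ▸ h.norm_tsum_sub_le hη x y
  have hae := h.ae_exists_mem hp hε hΩvol
  refine ⟨fun x => affMap X₀ b x + ∑' k, f k x, fun x => X₀ + ∑' k, H k x,
    ⟨?_, ?_, ?_, ?_⟩, ?_, ?_, ?_, ?_⟩
  · exact (h.hasWeakGrad_tsum hp hM hε hη hΩ.isOpen hΩvol).isW11_affMap_add hΩ.isBounded X₀ b
  · refine isPiecewiseAffineOn_of_affineNear (H := fun x => X₀ + ∑' k, H k x) hΩ ?_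
    filter_upwards [hae] with x hx hxΩ
    obtain ⟨n, hV, hK⟩ := hx hxΩ
    exact (affineNear_affMap X₀ b).add (h.affineNear_tsum hV hK)
  · obtain ⟨C, hC0, hC1, hC2⟩ := exists_holder_affMap hα₁.le X₀ b hΩ.isBounded.closure
    refine (holderENorm_le (C := C + δ / 4) ?_ ?_).trans_lt
      (ENNReal.add_lt_top.mpr ⟨ENNReal.ofReal_lt_top, ENNReal.ofReal_lt_top⟩)
    · exact fun x hx => (norm_add_le _ _).trans (add_le_add (hC1 x hx) (hF1 x))
    · intro x hx y hy
      rw [add_sub_add_comm, add_mul]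
      exact (norm_add_le _ _).trans (add_le_add (hC2 x hx y hy) (hF2 x y))
  · intro x hx
    have hxΩ : x ∉ Ω := fun hxΩ => hx.2 (by rwa [hΩ.isOpen.interior_eq])
    simp only [h.tsum_eq_zero hxΩ, add_zero]
  · rw [ae_restrict_iff' hΩ.isOpen.measurableSet]
    filter_upwards [hae] with x hx hxΩ
    obtain ⟨n, -, hK⟩ := hx hxΩ
    rwa [h.add_tsum_grad_eq hK]
  · simp only [add_sub_cancel_left]
    refine (holderENorm_le (fun x _ => hF1 x) fun x _ y _ => hF2 x y).trans_lt ?_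
    rw [← ENNReal.ofReal_add (by positivity) (by positivity)]
    exact (ENNReal.ofReal_lt_ofReal_iff hδ).mpr (by linarith)
  · set I := ∑' n, ∫⁻ x in B n, gradWeight p (G n x)
    have hI : I ≠ ⊤ := (h.tsum_setLIntegral_lt_top hε hΩvol).ne
    have hMp : 0 ≤ M ^ p := Real.rpow_nonneg hM p
    -- The summand `1` serves only to make the constant positive.
    refine ⟨M ^ p * I.toReal + 1, by positivity, fun t ht => ?_⟩
    have htp : 0 ≤ t ^ (-p) := Real.rpow_nonneg ht.le _
    refine (h.volume_lt_matNorm_le hp hε hΩvol ht).trans ?_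
    calc ENNReal.ofReal (M ^ p * t ^ (-p)) * I
        = ENNReal.ofReal (M ^ p * t ^ (-p) * I.toReal) := by
          rw [ENNReal.ofReal_mul (p := M ^ p * t ^ (-p)) (by positivity), ENNReal.ofReal_toReal hI]
      _ ≤ _ := ENNReal.ofReal_le_ofReal (by linarith)
  · intro hex
    have hc := hexact hex
    have hcp := Real.rpow_pos_of_pos hc p
    have hvolpos : 0 < (volume Ω).toReal :=
      ENNReal.toReal_pos (hΩ.isOpen.measure_pos volume hΩ.isConnected.nonempty).ne' hΩvol.ne
    refine ⟨c₀ ^ p / 2 * (volume Ω).toReal, by positivity, fun t ht => ?_⟩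
    have htp : 0 ≤ t ^ (-p) := Real.rpow_nonneg (by linarith) _
    refine le_trans (le_of_eq ?_) (h.le_volume_lt_matNorm hp hc ?_ hΩvol ht)
    · rw [mul_right_comm, ENNReal.ofReal_mul (by positivity), ENNReal.ofReal_toReal hΩvol.ne]
    · simpa [hεdef] using hec hc
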